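/- Let $\{\xi(t),t\ge 0\}$ be a real-valued Lévy process (started at $\xi(0)=0$, with stationary independent increments and cadlag sample paths) such that $\psi(u):=\log\mathbb E\,e^{u\xi(1)}$ is finite for all $u\in\mathbb R$, and suppose that the distribution of $\xi(1)$ is non-lattice, i.e. there are no $a,b\in\mathbb R$ such that $\xi(1)\in\{an+b:n\in\mathbb Z\}$ almost surely (in particular, $\xi(1)$ is not almost surely constant). Let $I(y)=\sup_{u\in\mathbb R}(uy-\psi(u))$ be the Legendre–Fenchel transform of $\psi$, so that $I(\psi'(u))=u\psi'(u)-\psi(u)$. Let $\kappa\ge 0$, and let $b_N\to\infty$ and $x_N\to\infty$ be two sequences of real numbers with $x_N\ge 0$. Then $\mathbb E\,e^{\kappa\xi(t)}<\infty$ for all $t\ge0$, and the following hold. (1) If for some $\vartheta\in\mathbb R$, $b_N=\psi'(\kappa)x_N+\vartheta\sqrt{\psi''(\kappa)x_N}+o(\sqrt{x_N})$ as $N\to\infty$, then $$\lim_{N\to\infty}e^{-\psi(\kappa)x_N}\,\mathbb E\big[e^{\kappa\xi(x_N)}1_{\xi(x_N)\le b_N}\big]=\Phi(\vartheta),$$ where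 $\Phi$ is the standard Gaussian distribution function. (2) If $\liminf_{N\to\infty}b_N/x_N>\psi'(\kappa)$, then $$\lim_{N\to\infty}e^{-\psi(\kappa)x_N}\,\mathbb E\big[e^{\kappa\xi(x_N)}1_{\xi(x_N)>b_N}\big]=0.$$ If, moreover, $\lim_{N\to\infty}b_N/x_N=\psi'(\alpha)$ for some $\alpha>\kappa$, then, as $N\to\infty$, $$\mathbb E\big[e^{\kappa\xi(x_N)}1_{\xi(x_N)>b_N}\big]\sim\frac{e^{\kappa b_N}}{(\alpha-\kappa)\sqrt{2\pi\psi''(\alpha)x_N}}\,e^{-I(b_N/x_N)x_N}.$$ (3) If $\limsup_{N\to\infty}b_N/x_N<\psi'(\kappa)$, then $$\lim_{N\to\infty}e^{-\psi(\kappa)x_N}\,\mathbb E\big[e^{\kappa\xi(x_N)}1_{\xi(x_N)\le b_N}\big]=0.$$ If, moreover, $\lim_{N\to\infty}b_N/x_N=\psi'(\alpha)$ for some $\alpha\in(0,\kappa)$, then, as $N\to\infty$, $$\mathbb E\big[e^{\kappa\xi(x_N)}1_{\xi(x_N)\le b_N}\big]\sim\frac{e^{\kappa b_N}}{(\kappa-\alpha)\sqrt{2\pi\psi''(\alpha)x_N}}\,e^{-I(b_N/x_N)x_N}.$$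 -/

import Mathlib

open MeasureTheory ProbabilityTheory Filter Topology Asymptotics
open scoped NNReal

/-- A real-valued Lévy process `(X t)`, `t ≥ 0`, on `(Ω, P)`: it starts at zero almost surely, has
independent and stationary increments, and almost surely cadlag sample paths. -/
structure IsLevyProcess {Ω : Type*} [MeasurableSpace Ω] (X : ℝ≥0 → Ω → ℝ) (P : Measure Ω) :
    Prop where
  measurable : ∀ t, Measurable (X t)
  start_zero : ∀ᵐ ω ∂P, X 0 ω = 0
  indep_increments : HasIndepIncrements X P
  stationary_increments :
    ∀ s t : ℝ≥0, IdentDistrib (fun ω => X (s + t) ω - X s ω) (X t) P P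
  cadlag : ∀ᵐ ω ∂P, ∀ t : ℝ≥0,
    ContinuousWithinAt (fun s => X s ω) (Set.Ici t) t ∧
      ∃ l : ℝ, Tendsto (fun s => X s ω) (𝓝[<] t) (𝓝 l)

/-- The distribution of `Y` is lattice: for some real `a`, `b`, the values of `Y` are almost surely
of the form `a * n + b` with `n` an integer. Almost surely constant variables are lattice
(`a = 0`). -/
def IsLatticeVar {Ω : Type*} [MeasurableSpace Ω] (Y : Ω → ℝ) (P : Measure Ω) : Prop :=
  ∃ a b : ℝ, ∀ᵐ ω ∂P, ∃ n : ℤ, Y ω = a * n + b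

/-- The Legendre–Fenchel transform `y ↦ sup_u (u y - ψ u)`. (It takes the value `0` where the
supremum is infinite; for a log-moment generating function `ψ` finite everywhere the supremum is
finite at every point `ψ' u`, see `legendreTransform_cgf_deriv`.) -/
noncomputable def legendreTransform (ψ : ℝ → ℝ) (y : ℝ) : ℝ :=
  ⨆ u : ℝ, (u * y - ψ u)

/-- If `ψ u = log E exp (u Y)` is finite for all real `u`, its Legendre–Fenchel transform satisfies
`I (ψ' u) = u ψ' u - ψ u`. -/
theorem legendreTransform_cgf_deriv {Ω : Type*} [MeasurableSpace Ω] (P : Measure Ω)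
    [IsProbabilityMeasure P] (Y : Ω → ℝ)
    (h : ∀ u : ℝ, Integrable (fun ω => Real.exp (u * Y ω)) P) (u : ℝ) :
    legendreTransform (cgf Y P) (deriv (cgf Y P) u) = u * deriv (cgf Y P) u - cgf Y P u := by
  have hset : integrableExpSet Y P = Set.univ := Set.eq_univ_of_forall h
  have hmem : ∀ v, v ∈ interior (integrableExpSet Y P) := fun v => by simp [hset]
  have han : ∀ v, AnalyticAt ℝ (cgf Y P) v := fun v => analyticAt_cgf (hmem v)
  have hd : Differentiable ℝ (cgf Y P) := fun v => (han v).differentiableAt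
  have hd' : Differentiable ℝ (deriv (cgf Y P)) := fun v => (han v).deriv.differentiableAt
  have hconv : ConvexOn ℝ Set.univ (cgf Y P) := by
    refine convexOn_univ_of_deriv2_nonneg hd hd' fun v => ?_
    rw [← iteratedDeriv_eq_iterate, ← variance_tilted_mul (hmem v)]
    exact variance_nonneg _ _
  have key : ∀ v, v * deriv (cgf Y P) u - cgf Y P v ≤ u * deriv (cgf Y P) u - cgf Y P u := by
    intro v
    rcases lt_trichotomy u v with huv | rfl | huv
    · have := hconv.deriv_le_slope (Set.mem_univ u) (Set.mem_univ v) huv (hd u)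
      rw [slope_def_field, le_div_iff₀ (by linarith)] at this
      linarith
    · exact le_rfl
    · have := hconv.slope_le_deriv (Set.mem_univ v) (Set.mem_univ u) huv (hd u)
      rw [slope_def_field, div_le_iff₀ (by linarith)] at this
      linarith
  exact le_antisymm (ciSup_le key) (le_ciSup_of_le ⟨_, by rintro _ ⟨v, rfl⟩; exact key v⟩ u le_rfl)

/-! Everything rests on exponential tilting. Since `ψ` is finite everywhere, the law of `ξ(t)` can
be reweighted by `exp (a x) / E exp (a ξ(t))`. The tilted laws again form a convolution semigroup,
with mean `t ψ'(a)` and variance `t ψ''(a)`, because the log-moment generating function of `ξ(t)` is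
`t ψ` (`IsLevyProcess.cgf_eq`, from additivity in `t` and right-continuity at zero).
`IsExpSemigroup` records what is needed of these laws.

With tilt `κ`, the normalised expectations are exactly tilted probabilities. Part 1 is then the
central limit theorem, and the limits equal to zero in parts 2 and 3 are Chebyshev's inequality.

For the exact asymptotics, choose the tilt `a_N` with `ψ'(a_N) = b_N / x_N`, so that `a_N → α` and
the threshold becomes the mean. The change of measure produces the factor `exp (κ b_N - I(b_N / x_N)
x_N)` times the integral of `exp ((κ - a_N) y)` over a half-line under the centred tilted law.
Multiplied by `√(2π ψ''(α) x_N)`, that integral tends to `1 / |α - κ|`. This is a local limit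
theorem of Stone type: at unit scale the rescaled laws look like Lebesgue measure.

The local limit theorem is proved by Fourier analysis. Non-latticeness gives the bound `exp (-c t s
^ 2)` on the characteristic functions for `s` in compact sets, locally uniformly in the tilt
(`exists_norm_charFun_tilted_le`), but no control at high frequencies. Hence the tests use a kernel
with compactly supported Fourier transform. The kernel `fejerSum` is also strictly positive, so it
can serve as a density: Lévy's continuity theorem for the reweighted laws extends the convergence to
all continuous functions of quadratic decay (`tendsto_integral_of_tendsto_integral_charFun`).
Half-exponentials are then squeezed between continuous ramps. -/

/-! ### A positive integrable kernel with compactly supported Fourier transform -/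

/-- The triangle function supported on `[-1, 1]`. -/
noncomputable def triangle (s : ℝ) : ℝ := max (1 - |s|) 0

lemma continuous_triangle : Continuous triangle := by unfold triangle; fun_prop

lemma triangle_eq_zero {s : ℝ} (hs : 1 ≤ |s|) : triangle s = 0 := max_eq_right (by linarith)

lemma triangle_eq_one_sub {s : ℝ} (hs : |s| ≤ 1) : triangle s = 1 - |s| := max_eq_left (by linarith)

lemma hasCompactSupport_triangle : HasCompactSupport triangle := by
  refine HasCompactSupport.intro (K := Set.Icc (-1) 1) isCompact_Icc fun s hs => ?_
  refine triangle_eq_zero ?_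
  by_contra h
  exact hs (abs_le.mp (not_le.mp h).le)

lemma integral_one_sub_mul_cexp {z : ℂ} (hz : z ≠ 0) :
    ∫ s in (0 : ℝ)..1, (1 - (s : ℂ)) * Complex.exp (z * s) =
      Complex.exp z / z ^ 2 - 1 / z - 1 / z ^ 2 := by
  have hd : ∀ s ∈ Set.uIcc (0 : ℝ) 1, HasDerivAt
      (fun s : ℝ => (1 - (s : ℂ)) * Complex.exp (z * s) / z + Complex.exp (z * s) / z ^ 2)
      ((1 - (s : ℂ)) * Complex.exp (z * s)) s := by
    intro s _
    have h1 : HasDerivAt (fun s : ℝ => (s : ℂ)) 1 s := Complex.ofRealCLM.hasDerivAt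
    have h2 : HasDerivAt (fun s : ℝ => Complex.exp (z * s)) (Complex.exp (z * s) * (z * 1)) s :=
      (h1.const_mul z).cexp
    have h3 := (((h1.const_sub 1).mul h2).div_const z).add (h2.div_const (z ^ 2))
    refine h3.congr_deriv ?_
    field_simp
    ring
  rw [intervalIntegral.integral_eq_sub_of_hasDerivAt hd
    (Continuous.intervalIntegrable (by fun_prop) _ _)]
  simp
  ring

/-- The two halves of the triangle are exchanged by `s ↦ -s`; together they give `2 (1 - cos x) / x
^ 2`, a square by the half-angle formula. -/
lemma integral_triangle_mul_cexp (x : ℝ) :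
    ∫ s : ℝ, (triangle s : ℂ) * Complex.exp (s * x * Complex.I) = (Real.sinc (x / 2) ^ 2 : ℝ) := by
  have hc : Continuous fun s : ℝ => (triangle s : ℂ) * Complex.exp (s * x * Complex.I) := by
    have := continuous_triangle
    fun_prop
  have h1 : ∫ s : ℝ, (triangle s : ℂ) * Complex.exp (s * x * Complex.I) =
      ∫ s in (-1 : ℝ)..1, (triangle s : ℂ) * Complex.exp (s * x * Complex.I) := by
    rw [intervalIntegral.integral_of_le (by norm_num), ← integral_Icc_eq_integral_Ioc,
      setIntegral_eq_integral_of_forall_compl_eq_zero]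
    intro s hs
    rw [triangle_eq_zero (s := s)]
    · simp
    · by_contra h
      exact hs (abs_le.mp (not_le.mp h).le)
  have h2 : ∀ y : ℝ, ∫ s in (0 : ℝ)..1, (triangle s : ℂ) * Complex.exp (s * y * Complex.I) =
      ∫ s in (0 : ℝ)..1, (1 - (s : ℂ)) * Complex.exp (y * Complex.I * s) := by
    intro y
    refine intervalIntegral.integral_congr fun s hs => ?_
    rw [Set.uIcc_of_le zero_le_one] at hs
    have : triangle s = 1 - s := by
      rw [triangle_eq_one_sub (by rw [abs_of_nonneg hs.1]; exact hs.2), abs_of_nonneg hs.1]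
    simp only [this]
    push_cast
    ring_nf
  have h3 : ∫ s in (-1 : ℝ)..0, (triangle s : ℂ) * Complex.exp (s * x * Complex.I) =
      ∫ s in (0 : ℝ)..1, (triangle s : ℂ) * Complex.exp (s * (-x : ℝ) * Complex.I) := by
    have := intervalIntegral.integral_comp_neg (a := 0) (b := 1)
      (fun s : ℝ => (triangle s : ℂ) * Complex.exp (s * x * Complex.I))
    simp only [neg_zero] at this
    rw [← this]
    refine intervalIntegral.integral_congr fun s _ => ?_
    simp [triangle]
  rw [h1, ← intervalIntegral.integral_add_adjacent_intervals (hc.intervalIntegrable _ 0)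
    (hc.intervalIntegrable _ _), h3, h2, h2]
  rcases eq_or_ne x 0 with rfl | hx
  · simp
    have : ∫ s in (0 : ℝ)..1, (1 - (s : ℂ)) = ((∫ s in (0 : ℝ)..1, (1 - s) : ℝ) : ℂ) := by
      rw [← intervalIntegral.integral_ofReal]; simp
    have h : ∫ s in (0 : ℝ)..1, (1 - s) = 1 / 2 := by
      rw [intervalIntegral.integral_sub (by simp) (by simp)]
      norm_num
    rw [this, h]
    norm_num
  · have hx' : (x : ℂ) ≠ 0 := by exact_mod_cast hx
    rw [integral_one_sub_mul_cexp (by simp [hx']), integral_one_sub_mul_cexp (by simp [hx']),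
      Real.sinc_of_ne_zero (by simpa using hx)]
    have hcos : (Real.sin (x / 2) : ℂ) ^ 2 = 1 / 2 - Complex.cos x / 2 := by
      rw [Complex.ofReal_sin, Complex.sin_sq, Complex.cos_sq]
      push_cast
      ring_nf
    have hcos' : Complex.cos x = (Complex.exp (x * Complex.I) + Complex.exp (-x * Complex.I)) / 2 := rfl
    push_cast [div_pow] at hcos ⊢
    rw [hcos, hcos']
    have hI : Complex.I ^ 2 = -1 := Complex.I_sq
    field_simp
    simp only [hI, neg_mul]
    ring

/-- The Fourier transform of `fejerSum`. -/
noncomputable def fejerSumTransform (s : ℝ) : ℂ :=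
  triangle s * (1 + Complex.exp (-(s * Real.pi * Complex.I)))

/-- The sum of two shifted Fejér kernels without common zeros. -/
noncomputable def fejerSum (x : ℝ) : ℝ :=
  Real.sinc (x / 2) ^ 2 + Real.sinc ((x - Real.pi) / 2) ^ 2

lemma continuous_fejerSumTransform : Continuous fejerSumTransform := by
  have := continuous_triangle
  unfold fejerSumTransform
  fun_prop

lemma hasCompactSupport_fejerSumTransform : HasCompactSupport fejerSumTransform := by
  have : HasCompactSupport fun s => (triangle s : ℂ) :=
    hasCompactSupport_triangle.comp_left (g := fun x : ℝ => (x : ℂ)) (by simp)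
  exact this.mul_right

lemma fejerSumTransform_zero : fejerSumTransform 0 = 2 := by
  simp [fejerSumTransform, triangle]; norm_num

lemma continuous_fejerSum : Continuous fejerSum := by
  have := Real.continuous_sinc
  unfold fejerSum
  fun_prop

/-- Shifting by `π` turns the sine in `sinc (x / 2)` into a cosine, so `sin ^ 2 + cos ^ 2 = 1`
writes `1` as a combination of the two squared sincs, with coefficients at most `5 (1 + x ^ 2)`. -/
lemma one_div_le_fejerSum (x : ℝ) : 1 / (5 * (1 + x ^ 2)) ≤ fejerSum x := by
  have key : ∀ y : ℝ, Real.sin y = y * Real.sinc y := fun y => by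
    rcases eq_or_ne y 0 with rfl | hy
    · simp
    · rw [Real.sinc_of_ne_zero hy]; field_simp
  have h1 := key (x / 2)
  have h2 : Real.cos (x / 2) = -((x - Real.pi) / 2 * Real.sinc ((x - Real.pi) / 2)) := by
    rw [← key, sub_div, Real.sin_sub_pi_div_two, neg_neg]
  have h3 := Real.sin_sq_add_cos_sq (x / 2)
  rw [h1, h2] at h3
  have hpi := Real.pi_lt_d2
  have hpi0 := Real.pi_pos
  have hpi2 : Real.pi ^ 2 ≤ 10 := by nlinarith
  rw [div_le_iff₀ (by positivity), fejerSum]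
  have e1 : (x / 2) ^ 2 ≤ 5 * (1 + x ^ 2) := by nlinarith [sq_nonneg x]
  have e2 : ((x - Real.pi) / 2) ^ 2 ≤ 5 * (1 + x ^ 2) := by nlinarith [sq_nonneg (x + Real.pi)]
  have f1 := mul_le_mul_of_nonneg_right e1 (sq_nonneg (Real.sinc (x / 2)))
  have f2 := mul_le_mul_of_nonneg_right e2 (sq_nonneg (Real.sinc ((x - Real.pi) / 2)))
  nlinarith

lemma fejerSum_pos (x : ℝ) : 0 < fejerSum x :=
  lt_of_lt_of_le (by positivity) (one_div_le_fejerSum x)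

lemma fejerSum_le_two (x : ℝ) : fejerSum x ≤ 2 := by
  have h : ∀ y, Real.sinc y ^ 2 ≤ 1 := fun y => by
    rw [sq_le_one_iff_abs_le_one]; exact Real.abs_sinc_le_one y
  have := h (x / 2)
  have := h ((x - Real.pi) / 2)
  unfold fejerSum
  linarith

lemma integrable_sinc_sq : Integrable fun y : ℝ => Real.sinc y ^ 2 := by
  have := Real.continuous_sinc
  refine (integrable_inv_one_add_sq.const_mul 2).mono' (by fun_prop) (ae_of_all _ fun y => ?_)
  rw [Real.norm_of_nonneg (sq_nonneg _), ← div_eq_mul_inv, le_div_iff₀ (by positivity)]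
  have h1 : Real.sinc y ^ 2 ≤ 1 := by
    rw [sq_le_one_iff_abs_le_one]; exact Real.abs_sinc_le_one y
  have h2 : (y * Real.sinc y) ^ 2 ≤ 1 := by
    rcases eq_or_ne y 0 with rfl | hy
    · simp
    · rw [Real.sinc_of_ne_zero hy, mul_div_cancel₀ _ hy]; exact Real.sin_sq_le_one y
  nlinarith

lemma integrable_fejerSum : Integrable fejerSum := by
  have h1 := integrable_sinc_sq.comp_div (two_ne_zero (α := ℝ))
  exact h1.add (h1.comp_sub_right Real.pi)

lemma fejerSum_eq_integral (x : ℝ) :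
    (fejerSum x : ℂ) = ∫ s : ℝ, fejerSumTransform s * Complex.exp (s * x * Complex.I) := by
  have hc : ∀ y : ℝ,
      Integrable fun s : ℝ => (triangle s : ℂ) * Complex.exp (s * y * Complex.I) := by
    intro y
    have h0 := continuous_triangle
    have : HasCompactSupport fun s => (triangle s : ℂ) :=
      hasCompactSupport_triangle.comp_left (g := fun x : ℝ => (x : ℂ)) (by simp)
    exact Continuous.integrable_of_hasCompactSupport (by fun_prop) this.mul_right
  have h1 := integral_triangle_mul_cexp x
  have h2 := integral_triangle_mul_cexp (x - Real.pi)
  rw [fejerSum, Complex.ofReal_add, ← h1, ← h2, ← integral_add (hc _) (hc _)]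
  refine integral_congr_ae (ae_of_all _ fun s => ?_)
  simp only [fejerSumTransform]
  have : (s : ℂ) * ((x - Real.pi : ℝ) : ℂ) * Complex.I =
      -(s * Real.pi * Complex.I) + s * x * Complex.I := by push_cast; ring
  rw [this, Complex.exp_add]
  ring

/-- Fourier inversion: up to the dilation by `-2π`, `fejerSum` is the Fourier transform of
`fejerSumTransform`, and both are integrable. -/
lemma integral_fejerSum_mul_cexp_volume (θ : ℝ) :
    ∫ x : ℝ, (fejerSum x : ℂ) * Complex.exp (θ * x * Complex.I) =
      2 * Real.pi * fejerSumTransform (-θ) := by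
  have hpi := Real.pi_pos
  have hF : FourierTransform.fourier fejerSumTransform =
      fun w => (fejerSum (-(2 * Real.pi) * w) : ℂ) := by
    ext w
    rw [Real.fourier_real_eq_integral_exp_smul, fejerSum_eq_integral]
    refine integral_congr_ae (ae_of_all _ fun s => ?_)
    simp only [smul_eq_mul]
    rw [mul_comm]
    push_cast
    ring_nf
  have hint : Integrable (FourierTransform.fourier fejerSumTransform) := by
    rw [hF]
    exact (integrable_fejerSum.comp_mul_left' (by simp [hpi.ne'])).ofReal
  have hinv := continuous_fejerSumTransform.fourierInv_fourier_eq
    (continuous_fejerSumTransform.integrable_of_hasCompactSupport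
      hasCompactSupport_fejerSumTransform) hint
  have h := congrFun hinv (-θ)
  rw [Real.fourierInv_eq', hF] at h
  rw [← h]
  have hsub := Measure.integral_comp_mul_left
    (fun x : ℝ => (fejerSum x : ℂ) * Complex.exp (θ * x * Complex.I)) (-(2 * Real.pi))
  have habs : |(-(2 * Real.pi))⁻¹| = (2 * Real.pi)⁻¹ := by
    rw [abs_inv, abs_neg, abs_of_pos (by positivity)]
  rw [habs] at hsub
  have h2 : ∫ x : ℝ, (fejerSum x : ℂ) * Complex.exp (θ * x * Complex.I) =
      (2 * Real.pi) • ∫ x : ℝ, (fejerSum (-(2 * Real.pi) * x) : ℂ) *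
        Complex.exp (θ * (-(2 * Real.pi) * x : ℝ) * Complex.I) := by
    rw [hsub, smul_smul, mul_inv_cancel₀ (by positivity), one_smul]
  rw [h2, Complex.real_smul]
  push_cast
  congr 1
  refine integral_congr_ae (ae_of_all _ fun s => ?_)
  simp only [smul_eq_mul]
  rw [mul_comm]
  congr 2
  simp
  ring

/-- Parseval by Fubini. Modulation by `θ` translates the transform, so only the values of `charFun
m` on a compact window matter. -/
lemma integral_fejerSum_mul_cexp (m : Measure ℝ) [IsProbabilityMeasure m] (θ : ℝ) :
    ∫ x : ℝ, (fejerSum x : ℂ) * Complex.exp (θ * x * Complex.I) ∂m =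
      ∫ s : ℝ, fejerSumTransform (s - θ) * charFun m s := by
  have hk : Integrable fejerSumTransform :=
    continuous_fejerSumTransform.integrable_of_hasCompactSupport hasCompactSupport_fejerSumTransform
  have hcont := continuous_fejerSumTransform
  have h1 : ∀ x : ℝ, (fejerSum x : ℂ) * Complex.exp (θ * x * Complex.I) =
      ∫ s : ℝ, fejerSumTransform (s - θ) * Complex.exp (s * x * Complex.I) := by
    intro x
    rw [fejerSum_eq_integral, ← integral_mul_const, ← integral_sub_right_eq_self _ θ]
    refine integral_congr_ae (ae_of_all _ fun s => ?_)
    simp only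
    rw [mul_assoc, ← Complex.exp_add]
    push_cast
    ring_nf
  simp_rw [h1]
  rw [integral_integral_swap]
  · refine integral_congr_ae (ae_of_all _ fun s => ?_)
    simp only
    rw [integral_const_mul, charFun_apply_real]
  · have : Integrable (fun p : ℝ × ℝ => fejerSumTransform (p.2 - θ)) (m.prod volume) :=
      Integrable.comp_snd (hk.comp_sub_right θ) m
    refine this.norm.mono' ?_ (ae_of_all _ fun p => ?_)
    · exact Continuous.aestronglyMeasurable (by unfold Function.uncurry; fun_prop)
    · simp only [Function.uncurry, norm_mul]
      rw [show ((p.2 : ℂ) * p.1 * Complex.I) = ((p.2 * p.1 : ℝ) : ℂ) * Complex.I by push_cast; ring,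
        Complex.norm_exp_ofReal_mul_I, mul_one]

/-! ### Local limits from characteristic functions -/

lemma exp_log_fejerSum (x : ℝ) : Real.exp (Real.log (fejerSum x)) = fejerSum x :=
  Real.exp_log (fejerSum_pos x)

lemma integrable_fejerSum_of_isProbabilityMeasure (m : Measure ℝ) [IsProbabilityMeasure m] :
    Integrable fejerSum m :=
  Integrable.of_bound continuous_fejerSum.aestronglyMeasurable 2
    (ae_of_all _ fun x => by
      rw [Real.norm_of_nonneg (fejerSum_pos x).le]; exact fejerSum_le_two x)

/-- Tilting by `log fejerSum` is reweighting by the density `fejerSum` and normalising; this also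
turns Lebesgue measure into a probability measure. -/
lemma charFun_tilted_log_fejerSum (m : Measure ℝ) (θ : ℝ) :
    charFun (m.tilted fun x => Real.log (fejerSum x)) θ =
      (∫ x, (fejerSum x : ℂ) * Complex.exp (θ * x * Complex.I) ∂m) / (∫ x, fejerSum x ∂m : ℝ) := by
  rw [charFun_apply_real, integral_tilted, ← integral_div]
  refine integral_congr_ae (ae_of_all _ fun x => ?_)
  simp only [exp_log_fejerSum, Complex.real_smul]
  push_cast
  ring

lemma integral_tilted_log_fejerSum (m : Measure ℝ) (g : ℝ → ℝ) :
    ∫ x, g x / fejerSum x ∂(m.tilted fun x => Real.log (fejerSum x)) =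
      (∫ x, g x ∂m) / ∫ x, fejerSum x ∂m := by
  rw [integral_tilted, ← integral_div]
  refine integral_congr_ae (ae_of_all _ fun x => ?_)
  simp only [exp_log_fejerSum, smul_eq_mul]
  have := (fejerSum_pos x).ne'
  field_simp

lemma integral_fejerSum_volume : ∫ x, fejerSum x = 4 * Real.pi := by
  have h := integral_fejerSum_mul_cexp_volume 0
  simp only [Complex.ofReal_zero, zero_mul, Complex.exp_zero, mul_one, neg_zero,
    fejerSumTransform_zero] at h
  rw [integral_complex_ofReal] at h
  have h' : ((∫ x, fejerSum x : ℝ) : ℂ) = ((4 * Real.pi : ℝ) : ℂ) := by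
    rw [h]; push_cast; ring
  exact_mod_cast h'

/-- If the characteristic functions of `m n`, multiplied by `c n`, converge to `2π` times the Dirac
mass at zero, then the measures `c n • m n` converge to Lebesgue measure when tested against
continuous functions of quadratic decay. -/
theorem tendsto_integral_of_tendsto_integral_charFun {m : ℕ → Measure ℝ}
    [∀ n, IsProbabilityMeasure (m n)] {c : ℕ → ℝ}
    (h : ∀ k : ℝ → ℂ, Continuous k → HasCompactSupport k →
      Tendsto (fun n => (c n : ℂ) * ∫ s, k s * charFun (m n) s) atTop (𝓝 (2 * Real.pi * k 0)))
    {g : ℝ → ℝ} (hg : Continuous g) {C : ℝ} (hC : ∀ x, |g x| ≤ C / (1 + x ^ 2)) :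
    Tendsto (fun n => c n * ∫ x, g x ∂(m n)) atTop (𝓝 (∫ x, g x)) := by
  have hpi := Real.pi_pos
  have hθ : ∀ θ : ℝ, Tendsto (fun n => (c n : ℂ) *
      ∫ x, (fejerSum x : ℂ) * Complex.exp (θ * x * Complex.I) ∂(m n)) atTop
      (𝓝 (∫ x, (fejerSum x : ℂ) * Complex.exp (θ * x * Complex.I))) := by
    intro θ
    have hcont := continuous_fejerSumTransform
    have := h (fun s => fejerSumTransform (s - θ)) (by fun_prop)
      (hasCompactSupport_fejerSumTransform.comp_homeomorph (Homeomorph.subRight θ))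
    simp_rw [integral_fejerSum_mul_cexp, integral_fejerSum_mul_cexp_volume]
    simpa using this
  have h0 : Tendsto (fun n => c n * ∫ x, fejerSum x ∂(m n)) atTop (𝓝 (∫ x, fejerSum x)) := by
    have h1 := hθ 0
    simp only [Complex.ofReal_zero, zero_mul, Complex.exp_zero, mul_one,
      integral_complex_ofReal] at h1
    have h2 := (Complex.continuous_re.tendsto _).comp h1
    simpa [Function.comp_def] using h2
  have hne : ∫ x, fejerSum x ≠ 0 := by rw [integral_fejerSum_volume]; positivity
  have hpm : ∀ n, IsProbabilityMeasure ((m n).tilted fun x => Real.log (fejerSum x)) := fun n =>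
    isProbabilityMeasure_tilted
      (by simpa only [exp_log_fejerSum] using integrable_fejerSum_of_isProbabilityMeasure (m n))
  have hpv : IsProbabilityMeasure
      ((volume : Measure ℝ).tilted fun x => Real.log (fejerSum x)) :=
    isProbabilityMeasure_tilted (by simpa only [exp_log_fejerSum] using integrable_fejerSum)
  have hmpos : ∀ n, 0 < ∫ x, fejerSum x ∂(m n) := fun n => by
    rw [integral_pos_iff_support_of_nonneg (fun x => (fejerSum_pos x).le)
      (integrable_fejerSum_of_isProbabilityMeasure (m n)),
      Function.support_eq_univ fun x => (fejerSum_pos x).ne']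
    simp
  have hc0 : ∀ᶠ n in atTop, c n ≠ 0 := by
    filter_upwards [h0.eventually_ne hne] with n hn h0
    simp [h0] at hn
  let p : ℕ → ProbabilityMeasure ℝ := fun n => ⟨_, hpm n⟩
  let q : ProbabilityMeasure ℝ := ⟨_, hpv⟩
  -- Lévy's continuity theorem for the reweighted measures; the factor `c n` cancels in the
  -- quotient.
  have hweak : Tendsto p atTop (𝓝 q) := by
    rw [ProbabilityMeasure.tendsto_iff_tendsto_charFun]
    intro θ
    simp only [p, q, ProbabilityMeasure.coe_mk, charFun_tilted_log_fejerSum]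
    have h0' : Tendsto (fun n => ((c n * ∫ x, fejerSum x ∂(m n) : ℝ) : ℂ)) atTop
        (𝓝 ((∫ x, fejerSum x : ℝ) : ℂ)) := (Complex.continuous_ofReal.tendsto _).comp h0
    refine ((hθ θ).div h0' (by exact_mod_cast hne)).congr' ?_
    filter_upwards [hc0] with n hn
    push_cast
    exact mul_div_mul_left _ _ (by exact_mod_cast hn)
  -- The quadratic lower bound on the kernel makes `g / fejerSum` bounded, hence an admissible test
  -- function for weak convergence.
  have hbc : ∀ x, |g x / fejerSum x| ≤ 5 * C := by
    intro x
    rw [abs_div, abs_of_pos (fejerSum_pos x), div_le_iff₀ (fejerSum_pos x)]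
    have hC0 : 0 ≤ C := by simpa using (abs_nonneg _).trans (hC 0)
    refine (hC x).trans ?_
    have := mul_le_mul_of_nonneg_left (one_div_le_fejerSum x) (by positivity : 0 ≤ 5 * C)
    refine le_trans (le_of_eq ?_) this
    field_simp
  have hgc : Continuous fun x => g x / fejerSum x :=
    hg.div continuous_fejerSum fun x => (fejerSum_pos x).ne'
  have hlim := ProbabilityMeasure.tendsto_iff_forall_integral_tendsto.mp hweak
    (BoundedContinuousFunction.ofNormedAddCommGroup _ hgc (5 * C) hbc)
  simp only [p, q, BoundedContinuousFunction.coe_ofNormedAddCommGroup, ProbabilityMeasure.coe_mk,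
    integral_tilted_log_fejerSum] at hlim
  have hfin := hlim.mul h0
  rw [div_mul_cancel₀ _ hne] at hfin
  refine hfin.congr fun n => ?_
  have := (hmpos n).ne'
  field_simp

/-! ### Half-exponential test functions and their continuous approximations. -/

lemma exp_neg_mul_le_div {a : ℝ} (ha : 0 < a) {y : ℝ} (hy : 0 ≤ y) :
    Real.exp (-(a * y)) ≤ (1 + 2 / a ^ 2) / (1 + y ^ 2) := by
  have h1 := Real.quadratic_le_exp_of_nonneg (mul_nonneg ha.le hy)
  rw [Real.exp_neg, le_div_iff₀ (by positivity), inv_mul_le_iff₀ (Real.exp_pos _)]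
  have h2 : (1 + 2 / a ^ 2) * (1 + (a * y) ^ 2 / 2) ≤ (1 + 2 / a ^ 2) * Real.exp (a * y) := by
    gcongr
    nlinarith [mul_nonneg ha.le hy]
  have h3 : (1 + 2 / a ^ 2) * (1 + (a * y) ^ 2 / 2) = 1 + y ^ 2 + (2 / a ^ 2 + a ^ 2 * y ^ 2 / 2) := by
    field_simp; ring
  have h4 : 0 ≤ 2 / a ^ 2 + a ^ 2 * y ^ 2 / 2 := by positivity
  linarith

/-- A continuous approximation of `y ↦ exp (-a y) 1_{y ≥ 0}`: the jump is replaced by the ramp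
`y ↦ (y + l) / d` cut off at `0` and `1`. -/
noncomputable def expRamp (a l d y : ℝ) : ℝ :=
  Real.exp (-(a * max y 0)) * min 1 (max 0 ((y + l) / d))

lemma continuous_expRamp (a l d : ℝ) : Continuous (expRamp a l d) := by
  unfold expRamp; fun_prop

lemma expRamp_nonneg (a l d y : ℝ) : 0 ≤ expRamp a l d y := by
  unfold expRamp; positivity

lemma expRamp_le (a l d y : ℝ) : expRamp a l d y ≤ Real.exp (-(a * max y 0)) := by
  unfold expRamp
  exact mul_le_of_le_one_right (Real.exp_pos _).le (min_le_left _ _)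

lemma expRamp_eq_zero {a l d y : ℝ} (hd : 0 < d) (hy : y + l ≤ 0) : expRamp a l d y = 0 := by
  unfold expRamp
  rw [max_eq_left (div_nonpos_of_nonpos_of_nonneg hy hd.le)]
  simp

lemma expRamp_eq {a l d y : ℝ} (hd : 0 < d) (hy : d ≤ y + l) :
    expRamp a l d y = Real.exp (-(a * max y 0)) := by
  unfold expRamp
  rw [min_eq_left (le_max_of_le_right ((one_le_div hd).mpr hy)), mul_one]

/-- For `l ≤ 1` the part of the support left of zero lies in `[-1, 0]`, where `1 + y ^ 2 ≤ 2`. -/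
lemma abs_expRamp_le {a l d : ℝ} (ha : 0 < a) (hd : 0 < d) (hl : l ≤ 1) (y : ℝ) :
    |expRamp a l d y| ≤ (2 + 2 / a ^ 2) / (1 + y ^ 2) := by
  rw [abs_of_nonneg (expRamp_nonneg _ _ _ _)]
  rcases le_total 0 y with hy | hy
  · refine (expRamp_le _ _ _ _).trans ?_
    rw [max_eq_left hy]
    refine (exp_neg_mul_le_div ha hy).trans ?_
    gcongr
    norm_num
  · rcases le_total (y + l) 0 with hyl | hyl
    · rw [expRamp_eq_zero hd hyl]; positivity
    · refine (expRamp_le _ _ _ _).trans ?_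
      rw [max_eq_right hy, mul_zero, neg_zero, Real.exp_zero, le_div_iff₀ (by positivity)]
      have : 0 ≤ 2 / a ^ 2 := by positivity
      nlinarith

lemma integrable_expRamp {a l d : ℝ} (ha : 0 < a) (hd : 0 < d) (hl : l ≤ 1) :
    Integrable (expRamp a l d) := by
  refine (integrable_inv_one_add_sq.const_mul (2 + 2 / a ^ 2)).mono'
    (continuous_expRamp _ _ _).aestronglyMeasurable (ae_of_all _ fun y => ?_)
  rw [← div_eq_mul_inv]
  exact abs_expRamp_le ha hd hl y

/-- With `l = d` the ramp rises on `[-d, 0]`, giving a majorant of the half-exponential at an extra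
area of at most `d`; with `l = 0` it rises on `[0, d]` and gives a minorant losing at most `d`. -/
lemma integral_expRamp_le {a d : ℝ} (ha : 0 < a) (hd : 0 < d) (hd1 : d ≤ 1) :
    ∫ y, expRamp a d d y ≤ 1 / a + d := by
  have hint := integrable_expRamp ha hd hd1
  have hE := integrableOn_exp_mul_Ioi (neg_lt_zero.mpr ha) 0
  have h1 : ∫ y, expRamp a d d y ≤ ∫ y, ((Set.Ioi (0 : ℝ)).indicator (fun y => Real.exp (-a * y)) y +
      (Set.Icc (-d) 0).indicator (fun _ => (1 : ℝ)) y) := by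
    refine integral_mono hint ?_ fun y => ?_
    · refine ((integrable_indicator_iff measurableSet_Ioi).mpr hE).add
        ((integrable_indicator_iff measurableSet_Icc).mpr ?_)
      simp
    · simp only
      rcases lt_or_ge 0 y with hy | hy
      · rw [Set.indicator_of_mem (Set.mem_Ioi.mpr hy),
          Set.indicator_of_notMem (fun h => absurd h.2 (not_le.mpr hy)), add_zero]
        refine (expRamp_le _ _ _ _).trans (le_of_eq ?_)
        rw [max_eq_left hy.le, neg_mul]
      · rw [Set.indicator_of_notMem (fun h => absurd (Set.mem_Ioi.mp h) (not_lt.mpr hy)), zero_add]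
        rcases le_or_gt (-d) y with hdy | hdy
        · rw [Set.indicator_of_mem (show y ∈ Set.Icc (-d) 0 from ⟨hdy, hy⟩)]
          refine (expRamp_le _ _ _ _).trans (le_of_eq ?_)
          rw [max_eq_right hy]; simp
        · rw [expRamp_eq_zero hd (by linarith)]
          exact Set.indicator_nonneg (fun _ _ => zero_le_one) _
  refine h1.trans (le_of_eq ?_)
  rw [integral_add ((integrable_indicator_iff measurableSet_Ioi).mpr hE)
    ((integrable_indicator_iff measurableSet_Icc).mpr (by simp)),
    integral_indicator measurableSet_Ioi, integral_indicator measurableSet_Icc,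
    integral_exp_mul_Ioi (neg_lt_zero.mpr ha)]
  simp [hd.le]

lemma le_integral_expRamp {a d : ℝ} (ha : 0 < a) (hd : 0 < d) :
    1 / a - d ≤ ∫ y, expRamp a 0 d y := by
  have hint := integrable_expRamp ha hd zero_le_one
  have hE := integrableOn_exp_mul_Ioi (neg_lt_zero.mpr ha) 0
  have h1 : ∫ y, ((Set.Ioi (0 : ℝ)).indicator (fun y => Real.exp (-a * y)) y -
      (Set.Icc 0 d).indicator (fun _ => (1 : ℝ)) y) ≤ ∫ y, expRamp a 0 d y := by
    refine integral_mono ?_ hint fun y => ?_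
    · refine ((integrable_indicator_iff measurableSet_Ioi).mpr hE).sub
        ((integrable_indicator_iff measurableSet_Icc).mpr ?_)
      simp
    · simp only
      rcases lt_or_ge 0 y with hy | hy
      · rw [Set.indicator_of_mem (Set.mem_Ioi.mpr hy)]
        rcases le_or_gt y d with hdy | hdy
        · rw [Set.indicator_of_mem (show y ∈ Set.Icc 0 d from ⟨hy.le, hdy⟩)]
          have := expRamp_nonneg a 0 d y
          have h2 : Real.exp (-a * y) ≤ 1 := Real.exp_le_one_iff.mpr (by nlinarith)
          linarith
        · rw [Set.indicator_of_notMem (fun h => absurd h.2 (not_le.mpr hdy)), sub_zero,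
            expRamp_eq hd (by linarith), max_eq_left hy.le, neg_mul]
      · rw [Set.indicator_of_notMem (fun h => absurd (Set.mem_Ioi.mp h) (not_lt.mpr hy))]
        have := expRamp_nonneg a 0 d y
        have h2 : 0 ≤ (Set.Icc 0 d).indicator (fun _ => (1 : ℝ)) y :=
          Set.indicator_nonneg (fun _ _ => zero_le_one) _
        linarith
  refine le_trans (le_of_eq ?_) h1
  rw [integral_sub ((integrable_indicator_iff measurableSet_Ioi).mpr hE)
    ((integrable_indicator_iff measurableSet_Icc).mpr (by simp)),
    integral_indicator measurableSet_Ioi, integral_indicator measurableSet_Icc,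
    integral_exp_mul_Ioi (neg_lt_zero.mpr ha)]
  simp [hd.le]

/-- Convergence to Lebesgue measure, tested against half-exponentials with converging rates. -/
theorem tendsto_integral_exp_of_tendsto_integral {m : ℕ → Measure ℝ}
    [∀ n, IsProbabilityMeasure (m n)] {c : ℕ → ℝ} (hc : ∀ᶠ n in atTop, 0 ≤ c n)
    (h : ∀ g : ℝ → ℝ, Continuous g → ∀ C : ℝ, (∀ x, |g x| ≤ C / (1 + x ^ 2)) →
      Tendsto (fun n => c n * ∫ x, g x ∂(m n)) atTop (𝓝 (∫ x, g x)))
    {a : ℕ → ℝ} {a₀ : ℝ} (ha₀ : 0 < a₀) (ha : Tendsto a atTop (𝓝 a₀)) {s : Set ℝ}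
    (hs : MeasurableSet s) (hs1 : Set.Ioi 0 ⊆ s) (hs2 : s ⊆ Set.Ici 0) :
    Tendsto (fun n => c n * ∫ y in s, Real.exp (-(a n * y)) ∂(m n)) atTop (𝓝 (1 / a₀)) := by
  have hint : ∀ (n : ℕ) {b l d : ℝ}, 0 ≤ b → Integrable (expRamp b l d) (m n) := by
    intro n b l d hb
    refine Integrable.of_bound (continuous_expRamp _ _ _).aestronglyMeasurable 1
      (ae_of_all _ fun y => ?_)
    rw [Real.norm_of_nonneg (expRamp_nonneg _ _ _ _)]
    refine (expRamp_le _ _ _ _).trans (Real.exp_le_one_iff.mpr ?_)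
    have := mul_nonneg hb (le_max_right y 0)
    linarith
  have hintE : ∀ n, 0 ≤ a n → Integrable (s.indicator fun y => Real.exp (-(a n * y))) (m n) := by
    intro n hn
    refine Integrable.of_bound ((Measurable.indicator (by fun_prop) hs).aestronglyMeasurable) 1
      (ae_of_all _ fun y => ?_)
    by_cases hy : y ∈ s
    · rw [Set.indicator_of_mem hy, Real.norm_of_nonneg (Real.exp_pos _).le, Real.exp_le_one_iff]
      have := mul_nonneg hn (hs2 hy)
      linarith
    · simp [Set.indicator_of_notMem hy]
  -- The hypothesis concerns a fixed test function, so the varying rate `a n` is compared with a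
  -- constant rate `b`. The majorant is `1` at zero and the minorant vanishes there, so it is
  -- immaterial whether `0 ∈ s`.
  have hupper : ∀ (d : ℝ), 0 < d → ∀ (n : ℕ) (b : ℝ), 0 ≤ b → b ≤ a n →
      ∫ y in s, Real.exp (-(a n * y)) ∂(m n) ≤ ∫ y, expRamp b d d y ∂(m n) := by
    intro d hd n b hb hba
    rw [← integral_indicator hs]
    refine integral_mono (hintE n (hb.trans hba)) (hint n hb) fun y => ?_
    by_cases hy : y ∈ s
    · have hy0 : 0 ≤ y := hs2 hy
      rw [Set.indicator_of_mem hy, expRamp_eq hd (by linarith), max_eq_left hy0]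
      gcongr
    · rw [Set.indicator_of_notMem hy]
      exact expRamp_nonneg _ _ _ _
  have hlower : ∀ (d : ℝ), 0 < d → ∀ (n : ℕ) (b : ℝ), 0 ≤ a n → a n ≤ b →
      ∫ y, expRamp b 0 d y ∂(m n) ≤ ∫ y in s, Real.exp (-(a n * y)) ∂(m n) := by
    intro d hd n b hn hba
    rw [← integral_indicator hs]
    refine integral_mono (hint n (hn.trans hba)) (hintE n hn) fun y => ?_
    by_cases hy : y ∈ s
    · have hy0 : 0 ≤ y := hs2 hy
      rw [Set.indicator_of_mem hy]
      refine (expRamp_le _ _ _ _).trans ?_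
      rw [max_eq_left hy0]
      gcongr
    · have hy0 : y ≤ 0 := not_lt.mp fun h => hy (hs1 h)
      rw [Set.indicator_of_notMem hy, expRamp_eq_zero hd (by linarith)]
  have hU : Tendsto (fun d => 1 / (a₀ - d) + d) (𝓝 0) (𝓝 (1 / a₀)) := by
    have : ContinuousAt (fun d => 1 / (a₀ - d) + d) 0 :=
      (continuousAt_const.div (by fun_prop) (by simpa using ha₀.ne')).add continuousAt_id
    simpa [ContinuousAt] using this
  have hL : Tendsto (fun d => 1 / (a₀ + d) - d) (𝓝 0) (𝓝 (1 / a₀)) := by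
    have : ContinuousAt (fun d => 1 / (a₀ + d) - d) 0 :=
      (continuousAt_const.div (by fun_prop) (by simpa using ha₀.ne')).sub continuousAt_id
    simpa [ContinuousAt] using this
  refine tendsto_order.mpr ⟨fun u hu => ?_, fun u hu => ?_⟩
  · have h1 : ∀ᶠ d in 𝓝[>] (0 : ℝ), u < 1 / (a₀ + d) - d :=
      (hL.mono_left nhdsWithin_le_nhds).eventually_const_lt hu
    obtain ⟨d, hud, hd⟩ := (h1.and self_mem_nhdsWithin).exists
    have hd : 0 < d := hd
    have h2 := h _ (continuous_expRamp (a₀ + d) 0 d) _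
      (abs_expRamp_le (by linarith) hd zero_le_one)
    filter_upwards [hc, h2.eventually_const_lt
      (hud.trans_le (le_integral_expRamp (by linarith) hd)), ha.eventually_const_lt ha₀,
      ha.eventually_lt_const (show a₀ < a₀ + d by linarith)] with n hcn h3 h4 h5
    exact h3.trans_le (mul_le_mul_of_nonneg_left (hlower d hd n _ h4.le h5.le) hcn)
  · have h1 : ∀ᶠ d in 𝓝[>] (0 : ℝ), 1 / (a₀ - d) + d < u :=
      (hU.mono_left nhdsWithin_le_nhds).eventually_lt_const hu
    -- This keeps the rate `a₀ - d` positive and the ramp inside `[-1, 0]`.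
    have h1' : ∀ᶠ d in 𝓝[>] (0 : ℝ), d < min a₀ 1 :=
      (tendsto_id.mono_left nhdsWithin_le_nhds).eventually_lt_const (lt_min ha₀ one_pos)
    obtain ⟨d, ⟨hud, hda⟩, hd⟩ := ((h1.and h1').and self_mem_nhdsWithin).exists
    have hd : 0 < d := hd
    have hda0 : d < a₀ := hda.trans_le (min_le_left _ _)
    have hd1 : d ≤ 1 := (hda.trans_le (min_le_right _ _)).le
    have h2 := h _ (continuous_expRamp (a₀ - d) d d) _
      (abs_expRamp_le (by linarith) hd hd1)
    filter_upwards [hc, h2.eventually_lt_const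
      ((integral_expRamp_le (by linarith) hd hd1).trans_lt hud),
      ha.eventually_const_lt (show a₀ - d < a₀ by linarith)] with n hcn h3 h5
    exact (mul_le_mul_of_nonneg_left (hupper d hd n _ (by linarith) h5.le) hcn).trans_lt h3

/-- A Gaussian limit of the characteristic functions at scale `√t`, with Gaussian domination on
compact sets, gives convergence to the Dirac mass in Fourier space. -/
theorem tendsto_integral_charFun_of_gaussian {m : ℕ → Measure ℝ}
    [∀ n, IsProbabilityMeasure (m n)] {t : ℕ → ℝ} (ht : Tendsto t atTop atTop) {v : ℝ} (hv : 0 < v)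
    (hlim : ∀ u : ℝ, Tendsto (fun n => charFun (m n) (u / √(t n))) atTop
      (𝓝 (Real.exp (-(v * u ^ 2 / 2)) : ℝ)))
    (hdom : ∀ S : ℝ, ∃ c > 0, ∀ᶠ n in atTop, ∀ s : ℝ, |s| ≤ S →
      ‖charFun (m n) s‖ ≤ Real.exp (-(c * t n * s ^ 2)))
    {k : ℝ → ℂ} (hk : Continuous k) (hks : HasCompactSupport k) :
    Tendsto (fun n => (√(2 * Real.pi * v * t n) : ℂ) * ∫ s, k s * charFun (m n) s) atTop
      (𝓝 (2 * Real.pi * k 0)) := by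
  have hpi := Real.pi_pos
  obtain ⟨S, hS⟩ : ∃ S : ℝ, ∀ s, S < |s| → k s = 0 := by
    obtain ⟨S, hS⟩ := hks.isCompact.isBounded.subset_closedBall 0
    refine ⟨S, fun s hs => ?_⟩
    by_contra hne
    have := hS (subset_tsupport k hne)
    rw [Metric.mem_closedBall, dist_zero_right, Real.norm_eq_abs] at this
    linarith
  obtain ⟨B, hB⟩ := hk.bounded_above_of_compact_support hks
  obtain ⟨c, hc, hdomc⟩ := hdom S
  have hsqrt : Tendsto (fun n => √(t n)) atTop atTop := Real.tendsto_sqrt_atTop.comp ht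
  -- After the substitution `s = u / √(t n)` the Gaussian domination becomes `exp (-c u ^ 2)`,
  -- independent of `n`. Outside the support of `k` no bound on the characteristic function is
  -- needed.
  have key : Tendsto (fun n => ∫ u : ℝ, k (u / √(t n)) * charFun (m n) (u / √(t n))) atTop
      (𝓝 (∫ u : ℝ, k 0 * (Real.exp (-(v * u ^ 2 / 2)) : ℝ))) := by
    refine tendsto_integral_filter_of_dominated_convergence
      (fun u => B * Real.exp (-c * u ^ 2)) (Eventually.of_forall fun n => ?_) ?_ ?_ ?_
    · have : Measurable fun u : ℝ => charFun (m n) (u / √(t n)) :=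
        measurable_charFun.comp (by fun_prop)
      exact ((hk.measurable.comp (by fun_prop)).mul this).aestronglyMeasurable
    · filter_upwards [hdomc, ht.eventually_gt_atTop 0] with n hn htn
      refine ae_of_all _ fun u => ?_
      rw [norm_mul]
      have hB0 : 0 ≤ B := (norm_nonneg _).trans (hB 0)
      rcases le_or_gt |u / √(t n)| S with hu | hu
      · refine mul_le_mul (hB _) ((hn _ hu).trans (le_of_eq ?_)) (norm_nonneg _) hB0
        rw [div_pow, Real.sq_sqrt htn.le]
        congr 1
        field_simp
      · rw [hS _ hu, norm_zero, zero_mul]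
        positivity
    · exact (integrable_exp_neg_mul_sq hc).const_mul B
    · refine ae_of_all _ fun u => ?_
      refine Tendsto.mul ?_ (hlim u)
      have : Tendsto (fun n => u / √(t n)) atTop (𝓝 0) := tendsto_const_nhds.div_atTop hsqrt
      exact (hk.tendsto 0).comp this
  have hgauss : ∫ u : ℝ, k 0 * (Real.exp (-(v * u ^ 2 / 2)) : ℝ) =
      k 0 * (√(2 * Real.pi / v) : ℝ) := by
    rw [integral_const_mul, integral_complex_ofReal]
    have := integral_gaussian (v / 2)
    rw [show Real.pi / (v / 2) = 2 * Real.pi / v by field_simp] at this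
    rw [← this]
    congr 3
    ext u
    ring_nf
  rw [hgauss] at key
  have h2 := key.const_mul ((√(2 * Real.pi * v) : ℝ) : ℂ)
  have hval : ((√(2 * Real.pi * v) : ℝ) : ℂ) * (k 0 * (√(2 * Real.pi / v) : ℝ)) =
      2 * Real.pi * k 0 := by
    have : √(2 * Real.pi * v) * √(2 * Real.pi / v) = 2 * Real.pi := by
      rw [← Real.sqrt_mul (by positivity), show 2 * Real.pi * v * (2 * Real.pi / v) =
        (2 * Real.pi) ^ 2 by field_simp, Real.sqrt_sq (by positivity)]
    calc _ = ((√(2 * Real.pi * v) * √(2 * Real.pi / v) : ℝ) : ℂ) * k 0 := by push_cast; ring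
      _ = _ := by rw [this]; push_cast; ring
  rw [hval] at h2
  refine h2.congr' ?_
  filter_upwards [ht.eventually_gt_atTop 0] with n htn
  have hs0 : 0 < √(t n) := Real.sqrt_pos.mpr htn
  rw [Measure.integral_comp_div (fun s => k s * charFun (m n) s), abs_of_pos hs0,
    Real.sqrt_mul (by positivity : 0 ≤ 2 * Real.pi * v), Complex.real_smul]
  push_cast
  ring

/-- The local limit theorem for half-exponentials. -/
theorem tendsto_integral_exp_of_gaussian {m : ℕ → Measure ℝ}
    [∀ n, IsProbabilityMeasure (m n)] {t : ℕ → ℝ} (ht : Tendsto t atTop atTop) {v : ℝ} (hv : 0 < v)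
    (hlim : ∀ u : ℝ, Tendsto (fun n => charFun (m n) (u / √(t n))) atTop
      (𝓝 (Real.exp (-(v * u ^ 2 / 2)) : ℝ)))
    (hdom : ∀ S : ℝ, ∃ c > 0, ∀ᶠ n in atTop, ∀ s : ℝ, |s| ≤ S →
      ‖charFun (m n) s‖ ≤ Real.exp (-(c * t n * s ^ 2)))
    {a : ℕ → ℝ} {a₀ : ℝ} (ha₀ : 0 < a₀) (ha : Tendsto a atTop (𝓝 a₀)) {s : Set ℝ}
    (hs : MeasurableSet s) (hs1 : Set.Ioi 0 ⊆ s) (hs2 : s ⊆ Set.Ici 0) :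
    Tendsto (fun n => √(2 * Real.pi * v * t n) * ∫ y in s, Real.exp (-(a n * y)) ∂(m n)) atTop
      (𝓝 (1 / a₀)) :=
  tendsto_integral_exp_of_tendsto_integral (Eventually.of_forall fun _ => Real.sqrt_nonneg _)
    (fun _ hg _ hC => tendsto_integral_of_tendsto_integral_charFun
      (fun _ hk hks => tendsto_integral_charFun_of_gaussian ht hv hlim hdom hk hks) hg hC)
    ha₀ ha hs hs1 hs2

/-- The reflected form of the local limit theorem for half-exponentials. -/
theorem tendsto_integral_exp_of_gaussian_neg {m : ℕ → Measure ℝ}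
    [∀ n, IsProbabilityMeasure (m n)] {t : ℕ → ℝ} (ht : Tendsto t atTop atTop) {v : ℝ} (hv : 0 < v)
    (hlim : ∀ u : ℝ, Tendsto (fun n => charFun (m n) (u / √(t n))) atTop
      (𝓝 (Real.exp (-(v * u ^ 2 / 2)) : ℝ)))
    (hdom : ∀ S : ℝ, ∃ c > 0, ∀ᶠ n in atTop, ∀ s : ℝ, |s| ≤ S →
      ‖charFun (m n) s‖ ≤ Real.exp (-(c * t n * s ^ 2)))
    {a : ℕ → ℝ} {a₀ : ℝ} (ha₀ : 0 < a₀) (ha : Tendsto a atTop (𝓝 a₀)) :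
    Tendsto (fun n => √(2 * Real.pi * v * t n) * ∫ y in Set.Iic 0, Real.exp (a n * y) ∂(m n)) atTop
      (𝓝 (1 / a₀)) := by
  have hpm : ∀ n, IsProbabilityMeasure ((m n).map fun x => -x) := fun n =>
    Measure.isProbabilityMeasure_map (by fun_prop)
  have hcf : ∀ n (s : ℝ), charFun ((m n).map fun x => -x) s = charFun (m n) (-s) := by
    intro n s
    rw [charFun_apply_real, integral_map (by fun_prop) (by fun_prop), charFun_apply_real]
    simp
  have h := tendsto_integral_exp_of_gaussian (m := fun n => (m n).map fun x => -x) ht hv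
    (fun u => by simpa [hcf, neg_div] using hlim (-u))
    (fun S => by
      obtain ⟨c, hc, h⟩ := hdom S
      refine ⟨c, hc, h.mono fun n hn s hs => ?_⟩
      rw [hcf]
      simpa using hn (-s) (by simpa using hs))
    ha₀ ha measurableSet_Ici Set.Ioi_subset_Ici_self subset_rfl
  refine h.congr fun n => ?_
  rw [setIntegral_map measurableSet_Ici (by fun_prop) (by fun_prop)]
  congr 2
  · congr 1; ext y; simp
  · ext y; simp

/-! ### Gaussian bound for the characteristic functions of tilted non-lattice laws -/

lemma one_sub_cos_eq (z : ℝ) : 1 - Real.cos z = z ^ 2 / 2 * Real.sinc (z / 2) ^ 2 := by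
  rcases eq_or_ne z 0 with rfl | hz
  · simp
  · have h1 := Real.cos_sq (z / 2)
    have h2 := Real.sin_sq_add_cos_sq (z / 2)
    rw [mul_div_cancel₀ _ two_ne_zero] at h1
    rw [Real.sinc_of_ne_zero (by simpa using hz)]
    field_simp
    linarith

/-- Symmetrisation: the squared modulus is the characteristic function of the difference of two
independent copies. -/
lemma normSq_charFun (ρ : Measure ℝ) [IsProbabilityMeasure ρ] (s : ℝ) :
    ‖charFun ρ s‖ ^ 2 = 1 - ∫ p : ℝ × ℝ, (1 - Real.cos (s * (p.1 - p.2))) ∂(ρ.prod ρ) := by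
  have hint : Integrable (fun p : ℝ × ℝ => Real.cos (s * (p.1 - p.2))) (ρ.prod ρ) :=
    Integrable.of_bound (Continuous.aestronglyMeasurable (by fun_prop)) 1
      (ae_of_all _ fun p => Real.abs_cos_le_one _)
  rw [integral_sub (integrable_const _) hint]
  simp only [integral_const, probReal_univ, smul_eq_mul, mul_one, sub_sub_cancel]
  have h1 : ((‖charFun ρ s‖ ^ 2 : ℝ) : ℂ) =
      ∫ p : ℝ × ℝ, Complex.exp ((s * (p.1 - p.2) : ℝ) * Complex.I) ∂(ρ.prod ρ) := by
    have : ((‖charFun ρ s‖ ^ 2 : ℝ) : ℂ) = charFun ρ s * charFun ρ (-s) := by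
      rw [charFun_neg, Complex.mul_conj, Complex.normSq_eq_norm_sq]
    rw [this, charFun_apply_real, charFun_apply_real, ← integral_prod_mul]
    refine integral_congr_ae (ae_of_all _ fun p => ?_)
    simp only
    rw [← Complex.exp_add]
    push_cast
    ring_nf
  have h2 := congrArg Complex.re h1
  rw [Complex.ofReal_re] at h2
  rw [h2]
  have hint2 : Integrable (fun p : ℝ × ℝ => Complex.exp ((s * (p.1 - p.2) : ℝ) * Complex.I))
      (ρ.prod ρ) :=
    Integrable.of_bound (Continuous.aestronglyMeasurable (by fun_prop)) 1
      (ae_of_all _ fun p => by rw [Complex.norm_exp_ofReal_mul_I])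
  have := integral_re hint2
  simp only [RCLike.re_eq_complex_re, Complex.exp_ofReal_mul_I_re] at this
  exact this.symm

/-- By Fubini some fixed second coordinate `y` works for almost every `x`, which then lies in `y +
(2π / s) ℤ`. -/
lemma isLatticeVar_of_ae_cos_eq_one {μ : Measure ℝ} [IsProbabilityMeasure μ] {s : ℝ} (hs : s ≠ 0)
    (h : ∀ᵐ p : ℝ × ℝ ∂(μ.prod μ), Real.cos (s * (p.1 - p.2)) = 1) : IsLatticeVar id μ := by
  have h' := Measure.ae_ae_of_ae_prod h
  obtain ⟨y, hy⟩ := h'.exists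
  refine ⟨2 * Real.pi / s, y, hy.mono fun x hx => ?_⟩
  obtain ⟨n, hn⟩ := (Real.cos_eq_one_iff _).mp hx
  refine ⟨-n, ?_⟩
  simp only [id]
  push_cast
  field_simp
  linarith

lemma isLatticeVar_of_ae_eq {μ : Measure ℝ} [IsProbabilityMeasure μ]
    (h : ∀ᵐ p : ℝ × ℝ ∂(μ.prod μ), p.1 = p.2) : IsLatticeVar id μ := by
  obtain ⟨y, hy⟩ := (Measure.ae_ae_of_ae_prod h).exists
  exact ⟨0, y, hy.mono fun x hx => ⟨0, by simpa using (show y = x from hx).symm⟩⟩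

/-- A lower bound for the tilting density that is uniform over tilts in `[A, B]`; the sign of `z`
decides which endpoint is smaller. -/
lemma min_exp_mul_le {A B a z : ℝ} (hA : A ≤ a) (hB : a ≤ B) :
    min (Real.exp (A * z)) (Real.exp (B * z)) ≤ Real.exp (a * z) := by
  rcases le_total 0 z with hz | hz
  · exact (min_le_left _ _).trans (Real.exp_le_exp.mpr (mul_le_mul_of_nonneg_right hA hz))
  · exact (min_le_right _ _).trans (Real.exp_le_exp.mpr (mul_le_mul_of_nonpos_right hB hz))

lemma integral_prod_tilted (μ : Measure ℝ) [IsProbabilityMeasure μ] (a : ℝ) (f : ℝ × ℝ → ℝ) :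
    ∫ p, f p ∂((μ.tilted (a * ·)).prod (μ.tilted (a * ·))) =
      ∫ p, Real.exp (a * (p.1 + p.2)) / (mgf id μ a) ^ 2 * f p ∂(μ.prod μ) := by
  unfold Measure.tilted
  rw [prod_withDensity (by fun_prop) (by fun_prop)]
  have : (fun z : ℝ × ℝ => ENNReal.ofReal (Real.exp (a * z.1) / ∫ x, Real.exp (a * x) ∂μ) *
      ENNReal.ofReal (Real.exp (a * z.2) / ∫ x, Real.exp (a * x) ∂μ)) =
      fun z => ENNReal.ofReal (Real.exp (a * (z.1 + z.2)) / (mgf id μ a) ^ 2) := by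
    ext z
    rw [← ENNReal.ofReal_mul (by positivity), mul_add, Real.exp_add]
    congr 1
    simp only [mgf, id]
    ring
  rw [this, integral_withDensity_eq_integral_toReal_smul (by fun_prop)
    (ae_of_all _ fun _ => ENNReal.ofReal_lt_top)]
  refine integral_congr_ae (ae_of_all _ fun p => ?_)
  simp only [smul_eq_mul]
  rw [ENNReal.toReal_ofReal (by positivity)]

/-- For a non-lattice law with finite exponential moments, the characteristic functions of the
tilted laws satisfy a Gaussian bound, locally uniformly in the tilt and the frequency. -/
theorem exists_norm_charFun_tilted_le {μ : Measure ℝ} [IsProbabilityMeasure μ]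
    (hexp : ∀ u : ℝ, Integrable (fun x => Real.exp (u * x)) μ) (hlat : ¬ IsLatticeVar id μ)
    (A B S : ℝ) :
    ∃ c > 0, ∀ a, A ≤ a → a ≤ B → ∀ s : ℝ, |s| ≤ S →
      ‖charFun (μ.tilted (a * ·)) s‖ ≤ Real.exp (-(c * s ^ 2)) := by
  have hsinc := Real.continuous_sinc
  set w : ℝ × ℝ → ℝ := fun p =>
    min (Real.exp (A * (p.1 + p.2))) (Real.exp (B * (p.1 + p.2))) with hw
  have hwc : Continuous w := by fun_prop
  have hw0 : ∀ p, 0 < w p := fun p => lt_min (Real.exp_pos _) (Real.exp_pos _)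
  -- This is `(1 - cos (s (p.1 - p.2))) w / s ^ 2`, written through `sinc` so that it stays
  -- continuous at `s = 0`. A positive minimum over `|s| ≤ S` then yields a quadratic lower bound
  -- down to frequency zero.
  set F : ℝ → ℝ × ℝ → ℝ := fun s p =>
    (p.1 - p.2) ^ 2 / 2 * Real.sinc (s * (p.1 - p.2) / 2) ^ 2 * w p with hF
  have hF0 : ∀ s p, 0 ≤ F s p := fun s p =>
    mul_nonneg (by positivity) (hw0 p).le
  have hFs : ∀ s p, s ^ 2 * F s p = (1 - Real.cos (s * (p.1 - p.2))) * w p := by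
    intro s p
    rw [one_sub_cos_eq, hF]
    ring
  have hFc : ∀ s, Continuous (F s) := fun s => by fun_prop
  have hexpprod : ∀ u v : ℝ, Integrable (fun p : ℝ × ℝ => Real.exp (u * p.1) * Real.exp (v * p.2))
      (μ.prod μ) := fun u v => (hexp u).mul_prod (hexp v)
  -- An integrable majorant of `F s` independent of `s`: half the squared difference is at most `exp
  -- (p.1 - p.2) + exp (p.2 - p.1)`, and the weight is at most `exp (A (p.1 + p.2))`.
  set G : ℝ × ℝ → ℝ := fun p =>
    Real.exp ((A + 1) * p.1) * Real.exp ((A - 1) * p.2) +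
      Real.exp ((A - 1) * p.1) * Real.exp ((A + 1) * p.2) with hG
  have hGint : Integrable G (μ.prod μ) := (hexpprod _ _).add (hexpprod _ _)
  have hFG : ∀ s p, F s p ≤ G p := by
    intro s p
    have h1 : Real.sinc (s * (p.1 - p.2) / 2) ^ 2 ≤ 1 := by
      rw [sq_le_one_iff_abs_le_one]; exact Real.abs_sinc_le_one _
    have h2 : (p.1 - p.2) ^ 2 / 2 ≤ Real.exp (p.1 - p.2) + Real.exp (-(p.1 - p.2)) := by
      have := Real.quadratic_le_exp_of_nonneg (abs_nonneg (p.1 - p.2))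
      have h3 := Real.exp_abs_le (p.1 - p.2)
      rw [sq_abs] at this
      have := abs_nonneg (p.1 - p.2)
      linarith
    have h3 : F s p ≤ (Real.exp (p.1 - p.2) + Real.exp (-(p.1 - p.2))) *
        Real.exp (A * (p.1 + p.2)) := by
      refine mul_le_mul ((mul_le_of_le_one_right (by positivity) h1).trans h2) (min_le_left _ _)
        (hw0 p).le (by positivity)
    refine h3.trans (le_of_eq ?_)
    rw [hG, add_mul]
    simp only [← Real.exp_add]
    ring_nf
  have hFint : ∀ s, Integrable (F s) (μ.prod μ) := fun s =>
    hGint.mono' (hFc s).aestronglyMeasurable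
      (ae_of_all _ fun p => by rw [Real.norm_of_nonneg (hF0 s p)]; exact hFG s p)
  have hHc : Continuous fun s => ∫ p, F s p ∂(μ.prod μ) := by
    refine continuous_of_dominated (fun s => (hFc s).aestronglyMeasurable)
      (fun s => ae_of_all _ fun p => by rw [Real.norm_of_nonneg (hF0 s p)]; exact hFG s p)
      hGint (ae_of_all _ fun p => ?_)
    simp only [hF]
    fun_prop
  -- Vanishing would force a constant law at `s = 0` and a lattice law at `s ≠ 0`.
  have hHpos : ∀ s, 0 < ∫ p, F s p ∂(μ.prod μ) := by
    intro s
    refine lt_of_le_of_ne (integral_nonneg (hF0 s)) fun h0 => hlat ?_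
    have hae := (integral_eq_zero_iff_of_nonneg (hF0 s) (hFint s)).mp h0.symm
    rcases eq_or_ne s 0 with rfl | hs
    · refine isLatticeVar_of_ae_eq (hae.mono fun p hp => ?_)
      have : (p.1 - p.2) ^ 2 / 2 * w p = 0 := by simpa [hF] using hp
      rcases mul_eq_zero.mp this with h | h
      · have : p.1 - p.2 = 0 := by simpa using h
        linarith
      · exact absurd h (hw0 p).ne'
    · refine isLatticeVar_of_ae_cos_eq_one hs (hae.mono fun p hp => ?_)
      have h1 := hFs s p
      rw [show F s p = 0 from hp, mul_zero] at h1
      rcases mul_eq_zero.mp h1.symm with h | h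
      · linarith
      · exact absurd h (hw0 p).ne'
  obtain ⟨δ, hδ, hHδ⟩ : ∃ δ > 0, ∀ s : ℝ, |s| ≤ S → δ ≤ ∫ p, F s p ∂(μ.prod μ) := by
    rcases lt_or_ge S 0 with hS | hS
    · exact ⟨1, one_pos, fun s hs => absurd (hs.trans_lt hS) (not_lt.mpr (abs_nonneg s))⟩
    · obtain ⟨s₀, _, hmin⟩ := isCompact_Icc.exists_isMinOn
        (Set.nonempty_Icc.mpr (by linarith : -S ≤ S)) hHc.continuousOn
      exact ⟨_, hHpos s₀, fun s hs => hmin (abs_le.mp hs)⟩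
  obtain ⟨M, hM, hMb⟩ : ∃ M > 0, ∀ a, A ≤ a → a ≤ B → mgf id μ a ^ 2 ≤ M := by
    have hmc : Continuous (mgf id μ) := continuous_mgf hexp
    obtain ⟨C, hC⟩ := (isCompact_Icc (a := A) (b := B)).bddAbove_image
      ((hmc.pow 2).continuousOn)
    refine ⟨max C 1, lt_max_of_lt_right one_pos, fun a h1 h2 => ?_⟩
    exact (hC ⟨a, ⟨h1, h2⟩, rfl⟩).trans (le_max_left _ _)
  -- The symmetrised bound `1 - s ^ 2 δ / M ≤ exp (-(s ^ 2 δ / M))` controls the squared modulus,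
  -- hence the factor `2`.
  refine ⟨δ / (2 * M), by positivity, fun a hA hB s hs => ?_⟩
  have hpm : IsProbabilityMeasure (μ.tilted (a * ·)) := isProbabilityMeasure_tilted (hexp a)
  have hmgf : 0 < mgf id μ a := mgf_pos (hexp a)
  have hbound : s ^ 2 * δ / M ≤
      ∫ p : ℝ × ℝ, (1 - Real.cos (s * (p.1 - p.2)))
        ∂((μ.tilted (a * ·)).prod (μ.tilted (a * ·))) := by
    rw [integral_prod_tilted]
    have h1 : s ^ 2 * δ / M ≤ ∫ p, s ^ 2 * F s p / M ∂(μ.prod μ) := by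
      rw [integral_div, integral_const_mul]
      have := hHδ s hs
      gcongr
    refine h1.trans (integral_mono (((hFint s).const_mul _).div_const _) ?_ fun p => ?_)
    · have h2 : Integrable (fun p : ℝ × ℝ => Real.exp (a * p.1) * Real.exp (a * p.2) /
          (mgf id μ a) ^ 2 * 2) (μ.prod μ) := ((hexpprod a a).div_const _).mul_const _
      refine h2.mono' (Continuous.aestronglyMeasurable (by fun_prop)) (ae_of_all _ fun p => ?_)
      have h3 := Real.neg_one_le_cos (s * (p.1 - p.2))
      have h4 := Real.cos_le_one (s * (p.1 - p.2))
      rw [Real.norm_of_nonneg (mul_nonneg (by positivity) (by linarith)), mul_add, Real.exp_add]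
      gcongr
      linarith
    · simp only
      rw [hFs, mul_comm, mul_div_right_comm]
      have h4 := Real.cos_le_one (s * (p.1 - p.2))
      refine mul_le_mul_of_nonneg_right ?_ (by linarith)
      gcongr
      · exact min_exp_mul_le hA hB
      · exact hMb a hA hB
  have h2 : ‖charFun (μ.tilted (a * ·)) s‖ ^ 2 ≤ Real.exp (-(δ / (2 * M) * s ^ 2)) ^ 2 := by
    rw [normSq_charFun, ← Real.exp_nat_mul]
    have h3 := Real.add_one_le_exp (-(s ^ 2 * δ / M))
    have h4 : ((2 : ℕ) : ℝ) * -(δ / (2 * M) * s ^ 2) = -(s ^ 2 * δ / M) := by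
      push_cast; field_simp
    rw [h4]
    linarith
  exact le_of_sq_le_sq h2 (Real.exp_pos _).le

/-! ### Exponential moments of Lévy processes -/

/-- An additive function on `[0, ∞)` that is bounded below near zero is linear. -/
lemma eq_mul_of_add_of_bddBelow {g : ℝ≥0 → ℝ} (hadd : ∀ s t, g (s + t) = g s + g t)
    {δ : ℝ≥0} (hδ : 0 < δ) {C : ℝ} (hC : ∀ t < δ, C ≤ g t) (t : ℝ≥0) : g t = t * g 1 := by
  -- With the linear part removed, `h` is additive and vanishes at nonnegative rationals; it remains
  -- to show that it is zero.
  set h : ℝ≥0 → ℝ := fun t => g t - t * g 1 with hh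
  have hhadd : ∀ s t, h (s + t) = h s + h t := fun s t => by
    simp only [hh, hadd]; push_cast; ring
  have h1 : h 1 = 0 := by simp [hh]
  have h0 : h 0 = 0 := by have := hhadd 0 0; simp only [add_zero] at this; linarith
  have hmul : ∀ (n : ℕ) (t : ℝ≥0), h (n * t) = n * h t := by
    intro n t
    induction n with
    | zero => simp [h0]
    | succ n ih => push_cast; rw [add_mul, one_mul, hhadd, ih]; ring
  have hnat : ∀ n : ℕ, h n = 0 := fun n => by
    have := hmul n 1; rw [mul_one, h1, mul_zero] at this; exact this
  have hrat : ∀ p q : ℕ, 0 < q → h (p / q) = 0 := by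
    intro p q hq
    have h2 := hmul q (p / q)
    have hq' : (q : ℝ≥0) ≠ 0 := by exact_mod_cast hq.ne'
    rw [mul_div_cancel₀ _ hq', hnat] at h2
    have hq'' : (q : ℝ) ≠ 0 := by exact_mod_cast hq.ne'
    simpa [hq''] using h2.symm
  obtain ⟨C', hC'⟩ : ∃ C', ∀ t < δ, C' ≤ h t := by
    refine ⟨C - δ * |g 1|, fun t ht => ?_⟩
    have h2 : (t : ℝ) * g 1 ≤ δ * |g 1| :=
      (mul_le_mul_of_nonneg_left (le_abs_self (g 1)) t.2).trans
        (mul_le_mul_of_nonneg_right (by exact_mod_cast ht.le) (abs_nonneg _))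
    have := hC t ht
    simp only [hh]
    linarith
  -- Subtracting a rational just below `t` does not change `h` and moves the argument into `[0, δ)`.
  have hbdd : ∀ t, C' ≤ h t := by
    intro t
    obtain ⟨q, hq⟩ := exists_nat_gt (1 / (δ : ℝ))
    have hδ' : (0 : ℝ) < δ := by exact_mod_cast hδ
    have hq0 : (0 : ℝ) < q := (by positivity : (0 : ℝ) < 1 / δ).trans hq
    have hqn : 0 < q := by exact_mod_cast hq0
    have hqq : (0 : ℝ≥0) < q := by exact_mod_cast hqn
    set p := ⌊t * q⌋₊
    have hp1 : (p : ℝ≥0) / q ≤ t := by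
      rw [div_le_iff₀ hqq]; exact Nat.floor_le (zero_le)
    have hp2 : t - (p : ℝ≥0) / q < δ := by
      have h3 : t * q < p + 1 := Nat.lt_floor_add_one _
      have h4 : t < p / q + 1 / q := by
        rw [← add_div, lt_div_iff₀ hqq]; exact h3
      have h5 : 1 / (q : ℝ≥0) < δ := by
        rw [div_lt_iff₀ hqq]
        rw [div_lt_iff₀ hδ'] at hq
        have : (1 : ℝ) < δ * q := by linarith
        exact_mod_cast this
      exact tsub_lt_iff_left hp1 |>.mpr (h4.trans (by gcongr))
    have h6 : h t = h (p / q) + h (t - p / q) := by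
      rw [← hhadd, add_tsub_cancel_of_le hp1]
    rw [h6, hrat p q hqn, zero_add]
    exact hC' _ hp2
  -- A negative value would have multiples violating the lower bound. Afterwards `h t` and `h (n -
  -- t)` are nonnegative with sum `h n = 0`.
  have hnonneg : ∀ t, 0 ≤ h t := by
    intro t
    by_contra hneg
    obtain ⟨n, hn⟩ := exists_nat_gt (C' / h t)
    rw [div_lt_iff_of_neg (not_le.mp hneg)] at hn
    have := hbdd (n * t)
    rw [hmul] at this
    linarith
  obtain ⟨n, hn⟩ := exists_nat_ge t
  have h7 : h n = h t + h (n - t) := by rw [← hhadd, add_tsub_cancel_of_le hn]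
  have h8 := hnonneg t
  have h9 := hnonneg (n - t)
  rw [hnat] at h7
  have h10 : h t = 0 := by linarith
  simp only [hh] at h10
  linarith

namespace IsLevyProcess

variable {Ω : Type*} [MeasurableSpace Ω] {X : ℝ≥0 → Ω → ℝ} {P : Measure Ω}

lemma indepFun_increment (hX : IsLevyProcess X P) (s t : ℝ≥0) :
    IndepFun (X s) (X (s + t) - X s) P :=
  hX.indep_increments.indepFun_eval_sub (zero_le) le_self_add hX.start_zero

lemma identDistrib_increment (hX : IsLevyProcess X P) (s t : ℝ≥0) :
    IdentDistrib (X (s + t) - X s) (X t) P P :=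
  hX.stationary_increments s t

/-- The exponential factors over independent increments, and neither factor vanishes. The forward
implication carries integrability from integer times down to earlier ones. -/
lemma integrable_exp_add_iff [IsProbabilityMeasure P] (hX : IsLevyProcess X P) (u : ℝ)
    (s t : ℝ≥0) :
    Integrable (fun ω => Real.exp (u * X (s + t) ω)) P ↔
      Integrable (fun ω => Real.exp (u * X s ω)) P ∧
        Integrable (fun ω => Real.exp (u * X t ω)) P := by
  have hm := hX.measurable
  have hf : Measurable fun x : ℝ => Real.exp (u * x) := by fun_prop
  have hind : IndepFun (fun ω => Real.exp (u * X s ω))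
      (fun ω => Real.exp (u * (X (s + t) - X s) ω)) P :=
    (hX.indepFun_increment s t).comp hf hf
  have hid : Integrable (fun ω => Real.exp (u * (X (s + t) - X s) ω)) P ↔
      Integrable (fun ω => Real.exp (u * X t ω)) P :=
    ((hX.identDistrib_increment s t).comp hf).integrable_iff
  have heq : (fun ω => Real.exp (u * X (s + t) ω)) =
      fun ω => Real.exp (u * X s ω) * Real.exp (u * (X (s + t) - X s) ω) := by
    ext ω
    rw [← Real.exp_add]
    simp only [Pi.sub_apply]
    ring_nf
  have hne : ∀ Y : Ω → ℝ, ¬ (fun ω => Real.exp (u * Y ω)) =ᵐ[P] 0 := fun Y h => by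
    obtain ⟨ω, hω⟩ := h.exists
    exact (Real.exp_pos _).ne' hω
  have hms : AEStronglyMeasurable (fun ω => Real.exp (u * X s ω)) P :=
    (hf.comp (hm s)).aestronglyMeasurable
  have hmi : AEStronglyMeasurable (fun ω => Real.exp (u * (X (s + t) - X s) ω)) P :=
    (hf.comp ((hm (s + t)).sub (hm s))).aestronglyMeasurable
  rw [heq, ← hid]
  constructor
  · intro h
    refine ⟨?_, ?_⟩
    · exact hind.integrable_left_of_integrable_op (fun x y => x * y) 1 one_ne_zero
        (fun x y => by simp) h hms hmi (hne _)
    · exact hind.integrable_right_of_integrable_op (fun x y => x * y) 1 one_ne_zero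
        (fun x y => by simp) h hms hmi (hne _)
  · exact fun h => hind.integrable_mul h.1 h.2

/-- Finiteness of the exponential moments of `X 1` gives that of all `X t`. -/
lemma integrable_exp_mul [IsProbabilityMeasure P] (hX : IsLevyProcess X P) {u : ℝ}
    (h1 : Integrable (fun ω => Real.exp (u * X 1 ω)) P) (t : ℝ≥0) :
    Integrable (fun ω => Real.exp (u * X t ω)) P := by
  have hnat : ∀ n : ℕ, Integrable (fun ω => Real.exp (u * X (n + 1) ω)) P := by
    intro n
    induction n with
    | zero => simpa using h1
    | succ n ih => push_cast; exact (hX.integrable_exp_add_iff u _ _).mpr ⟨ih, h1⟩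
  obtain ⟨n, hn⟩ := exists_nat_ge t
  have hle : t ≤ n + 1 := hn.trans le_self_add
  have := hnat n
  rw [← add_tsub_cancel_of_le hle, hX.integrable_exp_add_iff] at this
  exact this.1

/-- Complex arguments serve both the moment generating functions and the characteristic functions of
tilted laws. -/
lemma complexMGF_add [IsProbabilityMeasure P] (hX : IsLevyProcess X P) (s t : ℝ≥0) (z : ℂ) :
    complexMGF (X (s + t)) P z = complexMGF (X s) P z * complexMGF (X t) P z := by
  have hm := hX.measurable
  have hf : Measurable fun x : ℝ => Complex.exp (z * x) := by fun_prop
  have hind := (hX.indepFun_increment s t).comp hf hf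
  have hid := complexMGF_congr_identDistrib (hX.identDistrib_increment s t)
  rw [← hid]
  have := hind.integral_fun_mul_eq_mul_integral (hf.comp (hm s)).aestronglyMeasurable
    (hf.comp ((hm (s + t)).sub (hm s))).aestronglyMeasurable
  unfold complexMGF
  simp only [Function.comp_def, Pi.sub_apply] at this ⊢
  rw [← this]
  congr 1
  ext ω
  rw [← Complex.exp_add]
  push_cast
  ring_nf

lemma mgf_add [IsProbabilityMeasure P] (hX : IsLevyProcess X P) (s t : ℝ≥0) (u : ℝ) :
    mgf (X (s + t)) P u = mgf (X s) P u * mgf (X t) P u := by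
  have := hX.complexMGF_add s t u
  simp only [complexMGF_ofReal] at this
  exact_mod_cast this

/-- The moment generating functions of a Lévy process are bounded away from zero near time zero. -/
lemma exists_le_mgf [IsProbabilityMeasure P] (hX : IsLevyProcess X P) {u : ℝ}
    (h : ∀ t, Integrable (fun ω => Real.exp (u * X t ω)) P) :
    ∃ δ > 0, ∀ t < δ, 1 / 2 ≤ mgf (X t) P u := by
  by_contra hcon
  push Not at hcon
  choose τ hτ hτm using fun n : ℕ => hcon (1 / (n + 1)) (by positivity)
  have hτ0 : Tendsto τ atTop (𝓝 0) :=
    tendsto_of_tendsto_of_tendsto_of_le_of_le tendsto_const_nhds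
      (tendsto_one_div_add_atTop_nhds_zero_nat (𝕜 := ℝ≥0)) (fun _ => zero_le)
      (fun n => (hτ n).le)
  have hlim : ∀ᵐ ω ∂P, Tendsto (fun n => ENNReal.ofReal (Real.exp (u * X (τ n) ω))) atTop
      (𝓝 1) := by
    filter_upwards [hX.start_zero, hX.cadlag] with ω h0 hc
    have h1 : Tendsto (fun s => X s ω) (𝓝 0) (𝓝 0) := by
      have := (hc 0).1
      rw [ContinuousWithinAt, h0] at this
      rwa [show Set.Ici (0 : ℝ≥0) = Set.univ from Set.eq_univ_of_forall fun s => Set.mem_Ici.mpr zero_le,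
        nhdsWithin_univ] at this
    have h2 : Continuous fun x : ℝ => ENNReal.ofReal (Real.exp (u * x)) :=
      ENNReal.continuous_ofReal.comp (by fun_prop)
    have h3 := (h2.tendsto 0).comp (h1.comp hτ0)
    simpa [Function.comp_def] using h3
  have hmeas : ∀ n, Measurable fun ω => ENNReal.ofReal (Real.exp (u * X (τ n) ω)) := fun n => by
    have := hX.measurable (τ n)
    fun_prop
  -- Along `τ n → 0` right-continuity sends the integrand to `1`, so Fatou's lemma forbids
  -- expectations below `1 / 2`.
  have hfatou := lintegral_liminf_le (μ := P) (u := atTop) hmeas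
  have hle : ∫⁻ ω, liminf (fun n => ENNReal.ofReal (Real.exp (u * X (τ n) ω))) atTop ∂P = 1 := by
    rw [lintegral_congr_ae (g := fun _ => 1) (hlim.mono fun ω hω => hω.liminf_eq)]
    simp
  rw [hle] at hfatou
  have hupper : ∀ n, ∫⁻ ω, ENNReal.ofReal (Real.exp (u * X (τ n) ω)) ∂P ≤
      ENNReal.ofReal (1 / 2) := by
    intro n
    rw [← ofReal_integral_eq_lintegral_ofReal (h _) (ae_of_all _ fun _ => (Real.exp_pos _).le)]
    exact ENNReal.ofReal_le_ofReal (hτm n).le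
  have h5 := hfatou.trans (liminf_le_liminf (v := fun _ => ENNReal.ofReal (1 / 2))
    (Eventually.of_forall hupper))
  rw [liminf_const, ENNReal.one_le_ofReal] at h5
  norm_num at h5

/-- The cumulant generating function of a Lévy process is linear in time. -/
lemma cgf_eq [IsProbabilityMeasure P] (hX : IsLevyProcess X P) {u : ℝ}
    (h1 : Integrable (fun ω => Real.exp (u * X 1 ω)) P) (t : ℝ≥0) :
    cgf (X t) P u = t * cgf (X 1) P u := by
  have h := hX.integrable_exp_mul h1
  obtain ⟨δ, hδ, hb⟩ := hX.exists_le_mgf h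
  refine eq_mul_of_add_of_bddBelow (g := fun t => cgf (X t) P u) (fun s t => ?_) hδ
    (C := Real.log (1 / 2)) (fun t ht => Real.log_le_log (by norm_num) (hb t ht)) t
  simp only [cgf]
  rw [hX.mgf_add, Real.log_mul (mgf_pos (h s)).ne' (mgf_pos (h t)).ne']

end IsLevyProcess

/-! ### Exponentially tilted laws and their convolution semigroup. -/

lemma charFun_tilted (μ : Measure ℝ) (a s : ℝ) :
    charFun (μ.tilted (a * ·)) s = complexMGF id μ (a + s * Complex.I) / mgf id μ a := by
  rw [charFun_apply_real, integral_tilted, complexMGF, ← integral_div]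
  refine integral_congr_ae (ae_of_all _ fun x => ?_)
  simp only [Complex.real_smul, mgf, id]
  push_cast
  rw [add_mul, Complex.exp_add]
  ring_nf

/-- A family of laws on `ℝ`, indexed by `t ≥ 0`, that is a convolution semigroup with cumulant
generating functions `t ψ`. -/
structure IsExpSemigroup (μ : ℝ≥0 → Measure ℝ) (ψ : ℝ → ℝ) : Prop where
  isProbabilityMeasure : ∀ t, IsProbabilityMeasure (μ t)
  integrable_exp : ∀ t u, Integrable (fun x => Real.exp (u * x)) (μ t)
  cgf_eq : ∀ t, cgf id (μ t) = fun u => t * ψ u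
  charFun_tilted_add : ∀ s t a θ, charFun ((μ (s + t)).tilted (a * ·)) θ =
    charFun ((μ s).tilted (a * ·)) θ * charFun ((μ t).tilted (a * ·)) θ

lemma IsLevyProcess.isExpSemigroup {Ω : Type*} [MeasurableSpace Ω] {X : ℝ≥0 → Ω → ℝ}
    {P : Measure Ω} [IsProbabilityMeasure P] (hX : IsLevyProcess X P)
    (h1 : ∀ u, Integrable (fun ω => Real.exp (u * X 1 ω)) P) :
    IsExpSemigroup (fun t => P.map (X t)) (cgf (X 1) P) where
  isProbabilityMeasure t := Measure.isProbabilityMeasure_map (hX.measurable t).aemeasurable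
  integrable_exp t u := by
    rw [integrable_map_measure (by fun_prop) (hX.measurable t).aemeasurable]
    exact hX.integrable_exp_mul (h1 u) t
  cgf_eq t := by
    ext u
    rw [cgf, mgf_id_map (hX.measurable t).aemeasurable, ← hX.cgf_eq (h1 u) t, cgf]
  charFun_tilted_add s t a θ := by
    simp only [charFun_tilted, complexMGF_id_map (hX.measurable _).aemeasurable,
      mgf_id_map (hX.measurable _).aemeasurable, hX.complexMGF_add, hX.mgf_add]
    push_cast
    rw [mul_div_mul_comm]

/-! ### Gaussian limits for tilted convolution semigroups -/

/-- The Taylor estimate is needed for all `u`; when `|u| > 1` the triangle inequality already gives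
`2 + |u| ≤ 3 u ^ 2`. -/
lemma norm_cexp_ofReal_mul_I_sub_one_sub_le (u : ℝ) :
    ‖Complex.exp (u * Complex.I) - (1 + u * Complex.I)‖ ≤ 3 * u ^ 2 := by
  have hn : ‖(u : ℂ) * Complex.I‖ = |u| := by simp
  rcases le_or_gt |u| 1 with hu | hu
  · have h := Complex.exp_bound (x := u * Complex.I) (by rwa [hn]) (n := 2) (by norm_num)
    rw [hn, sq_abs] at h
    norm_num [Finset.sum_range_succ] at h
    nlinarith [sq_nonneg u]
  · calc ‖Complex.exp (u * Complex.I) - (1 + u * Complex.I)‖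
        ≤ ‖Complex.exp (u * Complex.I)‖ + (‖(1 : ℂ)‖ + ‖u * Complex.I‖) :=
          (norm_sub_le _ _).trans (add_le_add_right (norm_add_le _ _) _)
      _ = 2 + |u| := by rw [Complex.norm_exp_ofReal_mul_I, hn, norm_one]; ring
      _ ≤ 3 * u ^ 2 := by rw [← sq_abs u]; nlinarith

lemma norm_cexp_ofReal_mul_I_sub_taylor_two_le (u : ℝ) :
    ‖Complex.exp (u * Complex.I) - (1 + u * Complex.I - u ^ 2 / 2)‖ ≤ 4 * |u| ^ 3 := by
  have hn : ‖(u : ℂ) * Complex.I‖ = |u| := by simp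
  rcases le_or_gt |u| 1 with hu | hu
  · have h := Complex.exp_bound (x := u * Complex.I) (by rwa [hn]) (n := 3) (by norm_num)
    rw [hn] at h
    norm_num [Finset.sum_range_succ, Nat.factorial, mul_pow] at h
    have e : (1 : ℂ) + u * Complex.I + -(u : ℂ) ^ 2 / 2 = 1 + u * Complex.I - u ^ 2 / 2 := by ring
    rw [e] at h
    have : (0 : ℝ) ≤ |u| ^ 3 := by positivity
    linarith
  · have h := norm_cexp_ofReal_mul_I_sub_one_sub_le u
    have h2 : ‖(u : ℂ) ^ 2 / 2‖ = |u| ^ 2 / 2 := by simp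
    have h3 : Complex.exp (u * Complex.I) - (1 + u * Complex.I - u ^ 2 / 2) =
        Complex.exp (u * Complex.I) - (1 + u * Complex.I) + u ^ 2 / 2 := by ring
    rw [h3]
    refine (norm_add_le _ _).trans ?_
    rw [h2]
    rw [← sq_abs] at h
    have : |u| ^ 2 ≤ |u| ^ 3 := pow_le_pow_right₀ hu.le (by norm_num)
    nlinarith [sq_nonneg |u|]

lemma charFun_mul_cexp_eq (ρ : Measure ℝ) (M s : ℝ) :
    charFun ρ s * Complex.exp (-(s * M * Complex.I)) =
      ∫ x, Complex.exp ((s * (x - M) : ℝ) * Complex.I) ∂ρ := by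
  rw [charFun_apply_real, ← integral_mul_const]
  refine integral_congr_ae (ae_of_all _ fun x => ?_)
  simp only
  rw [← Complex.exp_add]
  push_cast
  ring_nf

lemma integrable_cexp_ofReal_mul_I (ρ : Measure ℝ) [IsFiniteMeasure ρ] (M s : ℝ) :
    Integrable (fun x : ℝ => Complex.exp ((s * (x - M) : ℝ) * Complex.I)) ρ :=
  Integrable.of_bound (Continuous.aestronglyMeasurable (by fun_prop)) 1
    (ae_of_all _ fun x => by rw [Complex.norm_exp_ofReal_mul_I])

/-- Used for the leftover time in `[0, 1)`, whose contribution only has to be shown negligible; the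
second-order version below serves the unit-time factors. -/
lemma norm_charFun_mul_cexp_sub_one_le {ρ : Measure ℝ} [IsProbabilityMeasure ρ] {M V : ℝ}
    (h1 : Integrable (fun x => x) ρ) (h2 : Integrable (fun x => (x - M) ^ 2) ρ)
    (hM : ∫ x, x ∂ρ = M) (hV : ∫ x, (x - M) ^ 2 ∂ρ = V) (s : ℝ) :
    ‖charFun ρ s * Complex.exp (-(s * M * Complex.I)) - 1‖ ≤ 3 * s ^ 2 * V := by
  have hI := integrable_cexp_ofReal_mul_I ρ M s
  have hlin : Integrable (fun x : ℝ => (1 : ℂ) + (s * (x - M) : ℝ) * Complex.I) ρ := by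
    refine (integrable_const _).add (Integrable.mul_const (Integrable.ofReal ?_) _)
    exact (h1.sub (integrable_const M)).const_mul s
  have hlin0 : ∫ x : ℝ, ((1 : ℂ) + (s * (x - M) : ℝ) * Complex.I) ∂ρ = 1 := by
    rw [integral_add (integrable_const _) (Integrable.mul_const (Integrable.ofReal
      ((h1.sub (integrable_const M)).const_mul s)) _), integral_mul_const, integral_complex_ofReal,
      integral_const_mul, integral_sub h1 (integrable_const M), hM]
    simp
  rw [charFun_mul_cexp_eq]
  rw [show (1 : ℂ) = ∫ x : ℝ, ((1 : ℂ) + (s * (x - M) : ℝ) * Complex.I) ∂ρ from hlin0.symm,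
    ← integral_sub hI hlin]
  calc _ ≤ ∫ x, 3 * s ^ 2 * (x - M) ^ 2 ∂ρ := by
        refine norm_integral_le_of_norm_le (h2.const_mul _) (ae_of_all _ fun x => ?_)
        refine (norm_cexp_ofReal_mul_I_sub_one_sub_le _).trans (le_of_eq ?_)
        ring
    _ = 3 * s ^ 2 * V := by rw [integral_const_mul, hV]

lemma norm_charFun_mul_cexp_sub_taylor_le {ρ : Measure ℝ} [IsProbabilityMeasure ρ] {M V : ℝ}
    (h1 : Integrable (fun x => x) ρ) (h2 : Integrable (fun x => (x - M) ^ 2) ρ)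
    (h3 : Integrable (fun x => |x - M| ^ 3) ρ)
    (hM : ∫ x, x ∂ρ = M) (hV : ∫ x, (x - M) ^ 2 ∂ρ = V) (s : ℝ) :
    ‖charFun ρ s * Complex.exp (-(s * M * Complex.I)) - (1 - s ^ 2 * V / 2 : ℝ)‖ ≤
      4 * |s| ^ 3 * ∫ x, |x - M| ^ 3 ∂ρ := by
  have hI := integrable_cexp_ofReal_mul_I ρ M s
  have hI1 : Integrable (fun x : ℝ => ((s * (x - M) : ℝ) : ℂ) * Complex.I) ρ :=
    Integrable.mul_const (Integrable.ofReal ((h1.sub (integrable_const M)).const_mul s)) _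
  have hI2 : Integrable (fun x : ℝ => ((s * (x - M) : ℝ) : ℂ) ^ 2 / 2) ρ := by
    have : Integrable (fun x : ℝ => ((s ^ 2 / 2 * (x - M) ^ 2 : ℝ) : ℂ)) ρ :=
      Integrable.ofReal (h2.const_mul (s ^ 2 / 2))
    refine this.congr (ae_of_all _ fun x => ?_)
    push_cast
    ring
  have hI01 : Integrable (fun x : ℝ => (1 : ℂ) + ((s * (x - M) : ℝ) : ℂ) * Complex.I) ρ :=
    (integrable_const _).add hI1
  have hI012 : Integrable (fun x : ℝ => (1 : ℂ) + ((s * (x - M) : ℝ) : ℂ) * Complex.I -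
      ((s * (x - M) : ℝ) : ℂ) ^ 2 / 2) ρ := hI01.sub hI2
  have hval : ∫ x : ℝ, ((1 : ℂ) + (s * (x - M) : ℝ) * Complex.I -
      ((s * (x - M) : ℝ) : ℂ) ^ 2 / 2) ∂ρ = ((1 - s ^ 2 * V / 2 : ℝ) : ℂ) := by
    rw [integral_sub hI01 hI2, integral_add (integrable_const _) hI1,
      integral_mul_const, integral_complex_ofReal,
      integral_const_mul, integral_sub h1 (integrable_const M), hM]
    have : ∫ x : ℝ, ((s * (x - M) : ℝ) : ℂ) ^ 2 / 2 ∂ρ =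
        ((∫ x : ℝ, s ^ 2 / 2 * (x - M) ^ 2 ∂ρ : ℝ) : ℂ) := by
      rw [← integral_complex_ofReal]
      refine integral_congr_ae (ae_of_all _ fun x => ?_)
      push_cast
      ring
    rw [this, integral_const_mul, hV]
    simp
    ring
  rw [charFun_mul_cexp_eq, ← hval, ← integral_sub hI hI012]
  calc _ ≤ ∫ x, 4 * |s| ^ 3 * |x - M| ^ 3 ∂ρ := by
        refine norm_integral_le_of_norm_le (h3.const_mul _) (ae_of_all _ fun x => ?_)
        refine (norm_cexp_ofReal_mul_I_sub_taylor_two_le _).trans (le_of_eq ?_)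
        rw [abs_mul]
        ring
    _ = _ := by rw [integral_const_mul]

lemma abs_pow_three_le_exp (z : ℝ) : |z| ^ 3 ≤ 6 * (Real.exp z + Real.exp (-z)) := by
  have h1 := Real.pow_div_factorial_le_exp _ (abs_nonneg z) 3
  have h2 := Real.exp_abs_le z
  norm_num [Nat.factorial] at h1
  linarith

lemma norm_pow_sub_pow_le_mul {a b : ℂ} (ha : ‖a‖ ≤ 1) (hb : ‖b‖ ≤ 1) (n : ℕ) :
    ‖a ^ n - b ^ n‖ ≤ n * ‖a - b‖ := by
  induction n with
  | zero => simp
  | succ n ih =>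
    have h : a ^ (n + 1) - b ^ (n + 1) = (a ^ n - b ^ n) * a + b ^ n * (a - b) := by ring
    rw [h]
    refine (norm_add_le _ _).trans ?_
    rw [norm_mul, norm_mul, norm_pow]
    have h1 : ‖a ^ n - b ^ n‖ * ‖a‖ ≤ ‖a ^ n - b ^ n‖ :=
      mul_le_of_le_one_right (norm_nonneg _) ha
    have h2 : ‖b‖ ^ n * ‖a - b‖ ≤ ‖a - b‖ :=
      mul_le_of_le_one_left (norm_nonneg _) (pow_le_one₀ (norm_nonneg _) hb)
    push_cast
    linarith

lemma abs_one_sub_sub_exp_neg_le {y : ℝ} (hy : 0 ≤ y) : |1 - y - Real.exp (-y)| ≤ y ^ 2 := by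
  have h1 := Real.add_one_le_exp (-y)
  have h2 : Real.exp (-y) * (1 + y) ≤ 1 := by
    have := Real.add_one_le_exp y
    calc Real.exp (-y) * (1 + y) ≤ Real.exp (-y) * Real.exp y := by gcongr; linarith
      _ = 1 := by rw [← Real.exp_add]; simp
  have h3 : Real.exp (-y) ≤ 1 - y + y ^ 2 := by
    have h4 : (1 : ℝ) ≤ (1 - y + y ^ 2) * (1 + y) := by nlinarith [pow_nonneg hy 3]
    exact le_of_mul_le_mul_right (h2.trans h4) (by linarith)
  rw [abs_le]
  constructor <;> nlinarith

namespace IsExpSemigroup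

variable {μ : ℝ≥0 → Measure ℝ} {ψ : ℝ → ℝ}

lemma eq_cgf (h : IsExpSemigroup μ ψ) : ψ = cgf id (μ 1) := by
  rw [h.cgf_eq 1]; simp

lemma mem_interior (h : IsExpSemigroup μ ψ) (t : ℝ≥0) (u : ℝ) :
    u ∈ interior (integrableExpSet id (μ t)) := by
  rw [show integrableExpSet id (μ t) = Set.univ from
    Set.eq_univ_of_forall fun u => h.integrable_exp t u]
  simp

lemma analyticAt (h : IsExpSemigroup μ ψ) (u : ℝ) : AnalyticAt ℝ ψ u := by
  rw [h.eq_cgf]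
  exact analyticAt_cgf (h.mem_interior 1 u)

lemma differentiable (h : IsExpSemigroup μ ψ) : Differentiable ℝ ψ :=
  fun u => (h.analyticAt u).differentiableAt

lemma differentiable_deriv (h : IsExpSemigroup μ ψ) : Differentiable ℝ (deriv ψ) :=
  fun u => (h.analyticAt u).deriv.differentiableAt

lemma continuous_iteratedDeriv_two (h : IsExpSemigroup μ ψ) :
    Continuous (iteratedDeriv 2 ψ) := by
  rw [iteratedDeriv_eq_iterate]
  exact continuous_iff_continuousAt.mpr fun u => (h.analyticAt u).deriv.deriv.continuousAt

lemma isProbabilityMeasure_tilted (h : IsExpSemigroup μ ψ) (t : ℝ≥0) (a : ℝ) :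
    IsProbabilityMeasure ((μ t).tilted (a * ·)) := by
  have := h.isProbabilityMeasure t
  exact MeasureTheory.isProbabilityMeasure_tilted (h.integrable_exp t a)

lemma mgf_eq (h : IsExpSemigroup μ ψ) (t : ℝ≥0) (a : ℝ) :
    mgf id (μ t) a = Real.exp (t * ψ a) := by
  have := h.isProbabilityMeasure t
  have h1 := exp_cgf (X := id) (h.integrable_exp t a)
  rw [← h1, h.cgf_eq]

lemma integrable_id_tilted (h : IsExpSemigroup μ ψ) (t : ℝ≥0) (a : ℝ) :
    Integrable (fun x => x) ((μ t).tilted (a * ·)) := by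
  have := h.isProbabilityMeasure_tilted t a
  have h1 := memLp_tilted_mul (h.mem_interior t a) 1
  exact memLp_one_iff_integrable.mp h1

lemma integral_id_tilted (h : IsExpSemigroup μ ψ) (t : ℝ≥0) (a : ℝ) :
    ∫ x, x ∂((μ t).tilted (a * ·)) = t * deriv ψ a := by
  have h1 := integral_tilted_mul_self (h.mem_interior t a)
  rw [h.cgf_eq, deriv_const_mul _ (h.differentiable a)] at h1
  exact h1

lemma integrable_sq_tilted (h : IsExpSemigroup μ ψ) (t : ℝ≥0) (a M : ℝ) :
    Integrable (fun x => (x - M) ^ 2) ((μ t).tilted (a * ·)) := by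
  have := h.isProbabilityMeasure_tilted t a
  have h1 := memLp_tilted_mul (h.mem_interior t a) 2
  exact (h1.sub (memLp_const M)).integrable_sq

lemma integral_sq_tilted (h : IsExpSemigroup μ ψ) (t : ℝ≥0) (a : ℝ) :
    ∫ x, (x - t * deriv ψ a) ^ 2 ∂((μ t).tilted (a * ·)) = t * iteratedDeriv 2 ψ a := by
  have h1 := variance_tilted_mul (h.mem_interior t a)
  rw [variance_eq_integral aemeasurable_id, h.cgf_eq] at h1
  simp only [id] at h1
  rw [h.integral_id_tilted, iteratedDeriv_const_mul_field] at h1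
  exact h1

lemma integrable_exp_tilted (h : IsExpSemigroup μ ψ) (t : ℝ≥0) (a u : ℝ) :
    Integrable (fun x => Real.exp (u * x)) ((μ t).tilted (a * ·)) := by
  rw [integrable_tilted_iff (h.integrable_exp t a)]
  refine (h.integrable_exp t (a + u)).congr (ae_of_all _ fun x => ?_)
  simp only [smul_eq_mul]
  rw [← Real.exp_add]
  ring_nf

lemma integral_exp_tilted (h : IsExpSemigroup μ ψ) (t : ℝ≥0) (a u : ℝ) :
    ∫ x, Real.exp (u * x) ∂((μ t).tilted (a * ·)) = Real.exp (t * (ψ (a + u) - ψ a)) := by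
  rw [MeasureTheory.integral_exp_tilted]
  have h1 := h.mgf_eq t a
  have h2 := h.mgf_eq t (a + u)
  simp only [mgf, id] at h1 h2
  rw [h1, mul_sub, Real.exp_sub, ← h2]
  congr 2
  ext x
  simp only [Pi.add_apply]
  ring_nf

/-- A bound for the third centred absolute moment of the tilted law, continuous in the tilt. -/
lemma integral_abs_pow_three_le (h : IsExpSemigroup μ ψ) (a M : ℝ) :
    Integrable (fun x => |x - M| ^ 3) ((μ 1).tilted (a * ·)) ∧
    ∫ x, |x - M| ^ 3 ∂((μ 1).tilted (a * ·)) ≤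
      6 * (Real.exp (ψ (a + 1) - ψ a - M) + Real.exp (ψ (a - 1) - ψ a + M)) := by
  have := h.isProbabilityMeasure_tilted 1 a
  have h1 := (h.integrable_exp_tilted 1 a 1).mul_const (Real.exp (-M))
  have h2 := (h.integrable_exp_tilted 1 a (-1)).mul_const (Real.exp M)
  have hle : ∀ x, |x - M| ^ 3 ≤ 6 * (Real.exp (1 * x) * Real.exp (-M) +
      Real.exp (-1 * x) * Real.exp M) := fun x => by
    refine (abs_pow_three_le_exp _).trans (le_of_eq ?_)
    rw [← Real.exp_add, ← Real.exp_add]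
    ring_nf
  have hint := (h1.add h2).const_mul 6
  have hI : Integrable (fun x => |x - M| ^ 3) ((μ 1).tilted (a * ·)) :=
    hint.mono' (Continuous.aestronglyMeasurable (by fun_prop))
      (ae_of_all _ fun x => by rw [Real.norm_of_nonneg (by positivity)]; exact hle x)
  refine ⟨hI, (integral_mono hI hint hle).trans (le_of_eq ?_)⟩
  simp only [Pi.add_apply]
  rw [integral_const_mul, integral_add h1 h2, integral_mul_const, integral_mul_const,
    h.integral_exp_tilted, h.integral_exp_tilted, ← Real.exp_add, ← Real.exp_add]
  simp [sub_eq_add_neg]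

lemma charFun_tilted_nat_add (h : IsExpSemigroup μ ψ) (n : ℕ) (r : ℝ≥0) (a s : ℝ) :
    charFun ((μ (n + r)).tilted (a * ·)) s =
      charFun ((μ 1).tilted (a * ·)) s ^ n * charFun ((μ r).tilted (a * ·)) s := by
  induction n with
  | zero => simp
  | succ n ih =>
    rw [show ((n + 1 : ℕ) : ℝ≥0) + r = 1 + (n + r) by push_cast; ring, h.charFun_tilted_add, ih]
    ring

/-- Reduces real times to powers of the unit-time law, at the price of one factor for the fractional
part of `t`. -/
lemma charFun_tilted_eq (h : IsExpSemigroup μ ψ) (t : ℝ≥0) (a s : ℝ) :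
    charFun ((μ t).tilted (a * ·)) s =
      charFun ((μ 1).tilted (a * ·)) s ^ ⌊t⌋₊ *
        charFun ((μ (t - ⌊t⌋₊)).tilted (a * ·)) s := by
  rw [← h.charFun_tilted_nat_add, add_tsub_cancel_of_le (Nat.floor_le zero_le)]

/-- Gaussian domination of the characteristic functions of the tilted laws. -/
lemma exists_norm_charFun_le (h : IsExpSemigroup μ ψ) (hlat : ¬ IsLatticeVar id (μ 1))
    {t : ℕ → ℝ≥0} (ht : Tendsto t atTop atTop) {a : ℕ → ℝ} {a₀ : ℝ}
    (ha : Tendsto a atTop (𝓝 a₀)) (S : ℝ) :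
    ∃ c > 0, ∀ᶠ n in atTop, ∀ s : ℝ, |s| ≤ S →
      ‖charFun ((μ (t n)).tilted (a n * ·)) s‖ ≤ Real.exp (-(c * t n * s ^ 2)) := by
  have := h.isProbabilityMeasure 1
  obtain ⟨c, hc, hb⟩ := exists_norm_charFun_tilted_le (h.integrable_exp 1) hlat
    (a₀ - 1) (a₀ + 1) S
  refine ⟨c / 2, by positivity, ?_⟩
  filter_upwards [ha.eventually_const_lt (show a₀ - 1 < a₀ by linarith),
    ha.eventually_lt_const (show a₀ < a₀ + 1 by linarith),
    ht.eventually_ge_atTop 1] with n h1 h2 h3 s hs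
  have hp := h.isProbabilityMeasure_tilted (t n - ⌊t n⌋₊) (a n)
  rw [h.charFun_tilted_eq, norm_mul, norm_pow]
  -- For `t n ≥ 1` the integer part is at least half of `t n`, which accounts for `c / 2`.
  have h4 : (t n : ℝ) / 2 ≤ ⌊t n⌋₊ := by
    have h5 : t n < ⌊t n⌋₊ + 1 := Nat.lt_floor_add_one _
    have h6 : 1 ≤ ⌊t n⌋₊ := by rwa [Nat.one_le_floor_iff]
    have h5' : (t n : ℝ) < ⌊t n⌋₊ + 1 := by exact_mod_cast h5
    have h6' : (1 : ℝ) ≤ ⌊t n⌋₊ := by exact_mod_cast h6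
    linarith
  calc _ ≤ Real.exp (-(c * s ^ 2)) ^ ⌊t n⌋₊ * 1 := by
        refine mul_le_mul (pow_le_pow_left₀ (norm_nonneg _) (hb _ h1.le h2.le s hs) _)
          (norm_charFun_le_one _) (norm_nonneg _) (by positivity)
    _ ≤ Real.exp (-(c / 2 * t n * s ^ 2)) := by
        rw [mul_one, ← Real.exp_nat_mul, Real.exp_le_exp]
        have := mul_le_mul_of_nonneg_right h4 (by positivity : 0 ≤ c * s ^ 2)
        linarith

lemma iteratedDeriv_two_nonneg (h : IsExpSemigroup μ ψ) (a : ℝ) : 0 ≤ iteratedDeriv 2 ψ a := by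
  have := h.integral_sq_tilted 1 a
  rw [NNReal.coe_one, one_mul, one_mul] at this
  rw [← this]
  exact integral_nonneg fun x => sq_nonneg _

/-- A quantitative central limit theorem whose error is explicit and continuous in `a`, so the tilt
may vary with time. The error has three sources: Taylor expansion of the unit-time factor,
replacement of `1 - y` by `exp (-y)`, and the fractional part of `t`. -/
lemma norm_charFun_pow_mul_cexp_sub_le (h : IsExpSemigroup μ ψ) (t : ℝ≥0) (a s : ℝ) :
    ‖charFun ((μ t).tilted (a * ·)) s * Complex.exp (-(s * (t * deriv ψ a : ℝ) * Complex.I)) -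
      Real.exp (-(⌊t⌋₊ * (s ^ 2 * iteratedDeriv 2 ψ a / 2)))‖ ≤
    t * (4 * |s| ^ 3 * (6 * (Real.exp (ψ (a + 1) - ψ a - deriv ψ a) +
      Real.exp (ψ (a - 1) - ψ a + deriv ψ a))) + (s ^ 2 * iteratedDeriv 2 ψ a / 2) ^ 2) +
      3 * s ^ 2 * iteratedDeriv 2 ψ a := by
  set r : ℝ≥0 := t - ⌊t⌋₊ with hr
  have hfl : (⌊t⌋₊ : ℝ≥0) ≤ t := Nat.floor_le zero_le
  have hr1 : (r : ℝ) ≤ 1 := by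
    have h5 : t < ⌊t⌋₊ + 1 := Nat.lt_floor_add_one _
    have : r ≤ 1 := by rw [hr, tsub_le_iff_left]; exact h5.le
    exact_mod_cast this
  have ht : (t : ℝ) = ⌊t⌋₊ + r := by
    have : t = ⌊t⌋₊ + r := (add_tsub_cancel_of_le hfl).symm
    exact_mod_cast congrArg (fun x : ℝ≥0 => (x : ℝ)) this
  have hfl' : (⌊t⌋₊ : ℝ) ≤ t := by rw [ht]; linarith [r.2]
  set V := iteratedDeriv 2 ψ a
  have hV : 0 ≤ V := h.iteratedDeriv_two_nonneg a
  set m := deriv ψ a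
  have hp1 := h.isProbabilityMeasure_tilted 1 a
  have hpr := h.isProbabilityMeasure_tilted r a
  set f : ℂ := charFun ((μ 1).tilted (a * ·)) s * Complex.exp (-(s * m * Complex.I)) with hf
  set g : ℂ := charFun ((μ r).tilted (a * ·)) s *
    Complex.exp (-(s * (r * m : ℝ) * Complex.I)) with hg
  have hexpn : ∀ y : ℝ, ‖Complex.exp (-(s * y * Complex.I))‖ = 1 := fun y => by
    rw [show -((s : ℂ) * y * Complex.I) = ((-(s * y) : ℝ) : ℂ) * Complex.I by push_cast; ring,
      Complex.norm_exp_ofReal_mul_I]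
  have hfn : ‖f‖ ≤ 1 := by
    rw [hf, norm_mul, hexpn, mul_one]; exact norm_charFun_le_one _
  have hfg : charFun ((μ t).tilted (a * ·)) s *
      Complex.exp (-(s * (t * m : ℝ) * Complex.I)) = f ^ ⌊t⌋₊ * g := by
    rw [h.charFun_tilted_eq, ← hr, hf, hg, mul_pow, ← Complex.exp_nat_mul, ht]
    have : -((s : ℂ) * (((⌊t⌋₊ + r : ℝ) * m : ℝ) : ℂ) * Complex.I) =
        ⌊t⌋₊ * -(s * m * Complex.I) + -(s * (r * m : ℝ) * Complex.I) := by push_cast; ring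
    rw [this, Complex.exp_add]
    ring
  set b : ℂ := ((Real.exp (-(s ^ 2 * V / 2)) : ℝ) : ℂ) with hb
  have hbn : ‖b‖ ≤ 1 := by
    rw [hb, Complex.norm_real, Real.norm_of_nonneg (Real.exp_pos _).le, Real.exp_le_one_iff]
    have : 0 ≤ s ^ 2 * V / 2 := by positivity
    linarith
  have hbpow : ((Real.exp (-(⌊t⌋₊ * (s ^ 2 * V / 2))) : ℝ) : ℂ) = b ^ ⌊t⌋₊ := by
    rw [hb, ← Complex.ofReal_pow, ← Real.exp_nat_mul]
    congr 2
    ring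
  obtain ⟨h3i, h3b⟩ := h.integral_abs_pow_three_le a m
  have hMean : ∫ x, x ∂((μ 1).tilted (a * ·)) = m := by
    have := h.integral_id_tilted 1 a
    simpa using this
  have hVar : ∫ x, (x - m) ^ 2 ∂((μ 1).tilted (a * ·)) = V := by
    have := h.integral_sq_tilted 1 a
    simpa using this
  have hfb : ‖f - b‖ ≤ 4 * |s| ^ 3 * (6 * (Real.exp (ψ (a + 1) - ψ a - m) +
      Real.exp (ψ (a - 1) - ψ a + m))) + (s ^ 2 * V / 2) ^ 2 := by
    have e1 := norm_charFun_mul_cexp_sub_taylor_le (h.integrable_id_tilted 1 a)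
      (h.integrable_sq_tilted 1 a m) h3i hMean hVar s
    have e2 := abs_one_sub_sub_exp_neg_le (y := s ^ 2 * V / 2) (by positivity)
    have e3 : ‖((1 - s ^ 2 * V / 2 : ℝ) : ℂ) - b‖ ≤ (s ^ 2 * V / 2) ^ 2 := by
      rw [hb, ← Complex.ofReal_sub, Complex.norm_real]; exact e2
    have e4 := mul_le_mul_of_nonneg_left h3b (by positivity : 0 ≤ 4 * |s| ^ 3)
    have e5 := norm_sub_le_norm_sub_add_norm_sub f ((1 - s ^ 2 * V / 2 : ℝ) : ℂ) b
    linarith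
  have hg1 : ‖g - 1‖ ≤ 3 * s ^ 2 * V := by
    have e1 := norm_charFun_mul_cexp_sub_one_le (h.integrable_id_tilted r a)
      (h.integrable_sq_tilted r a (r * m)) (h.integral_id_tilted r a)
      (h.integral_sq_tilted r a) s
    refine e1.trans ?_
    have : (r : ℝ) * V ≤ V := mul_le_of_le_one_left hV hr1
    gcongr
  rw [hfg, hbpow]
  have hsplit : f ^ ⌊t⌋₊ * g - b ^ ⌊t⌋₊ = (f ^ ⌊t⌋₊ - b ^ ⌊t⌋₊) + f ^ ⌊t⌋₊ * (g - 1) := by ring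
  rw [hsplit]
  refine (norm_add_le _ _).trans (add_le_add ?_ ?_)
  · refine (norm_pow_sub_pow_le_mul hfn hbn _).trans ?_
    exact mul_le_mul hfl' hfb (norm_nonneg _) t.2
  · rw [norm_mul, norm_pow]
    exact (mul_le_of_le_one_left (norm_nonneg _) (pow_le_one₀ (norm_nonneg _) hfn)).trans hg1

/-- The central limit theorem for the tilted laws, in terms of characteristic functions. -/
theorem tendsto_charFun (h : IsExpSemigroup μ ψ) {t : ℕ → ℝ≥0} (ht : Tendsto t atTop atTop)
    {a : ℕ → ℝ} {a₀ : ℝ} (ha : Tendsto a atTop (𝓝 a₀)) (u : ℝ) :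
    Tendsto (fun n => charFun ((μ (t n)).tilted (a n * ·)) (u / √(t n)) *
      Complex.exp (-((u / √(t n) : ℝ) * (t n * deriv ψ (a n) : ℝ) * Complex.I))) atTop
      (𝓝 (Real.exp (-(iteratedDeriv 2 ψ a₀ * u ^ 2 / 2)) : ℝ)) := by
  have htR : Tendsto (fun n => (t n : ℝ)) atTop atTop := NNReal.tendsto_coe_atTop.mpr ht
  have hsq : Tendsto (fun n => √(t n : ℝ)) atTop atTop := Real.tendsto_sqrt_atTop.comp htR
  have hψc : Continuous ψ := h.differentiable.continuous
  have hψ'c : Continuous (deriv ψ) := h.differentiable_deriv.continuous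
  have hV : Tendsto (fun n => iteratedDeriv 2 ψ (a n)) atTop (𝓝 (iteratedDeriv 2 ψ a₀)) :=
    (h.continuous_iteratedDeriv_two.tendsto a₀).comp ha
  set D : ℝ → ℝ := fun a => 6 * (Real.exp (ψ (a + 1) - ψ a - deriv ψ a) +
      Real.exp (ψ (a - 1) - ψ a + deriv ψ a)) with hD
  have hDc : Continuous D := by fun_prop
  have hDt : Tendsto (fun n => D (a n)) atTop (𝓝 (D a₀)) := (hDc.tendsto a₀).comp ha
  have hfloor : Tendsto (fun n => (⌊t n⌋₊ : ℝ) / t n) atTop (𝓝 1) := by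
    have := (tendsto_nat_floor_div_atTop (R := ℝ)).comp htR
    refine this.congr fun n => ?_
    rw [Function.comp_apply]
    rfl
  have hmain : Tendsto (fun n => Real.exp (-(⌊t n⌋₊ *
      ((u / √(t n)) ^ 2 * iteratedDeriv 2 ψ (a n) / 2)))) atTop
      (𝓝 (Real.exp (-(iteratedDeriv 2 ψ a₀ * u ^ 2 / 2)))) := by
    refine (Real.continuous_exp.tendsto _).comp ?_
    have := ((hfloor.mul hV).mul_const (u ^ 2 / 2)).neg
    rw [show -(1 * iteratedDeriv 2 ψ a₀ * (u ^ 2 / 2)) =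
      -(iteratedDeriv 2 ψ a₀ * u ^ 2 / 2) by ring] at this
    refine this.congr fun n => ?_
    rw [div_pow, Real.sq_sqrt (t n).coe_nonneg]
    ring
  -- At `s = u / √t` the three errors are of order `t ^ (-1/2)`, `t ^ (-1)` and `t ^ (-1)`.
  have herr : Tendsto (fun n => (t n : ℝ) * (4 * |u / √(t n)| ^ 3 * D (a n) +
      ((u / √(t n)) ^ 2 * iteratedDeriv 2 ψ (a n) / 2) ^ 2) +
      3 * (u / √(t n)) ^ 2 * iteratedDeriv 2 ψ (a n)) atTop (𝓝 0) := by
    have hi1 : Tendsto (fun n => (√(t n : ℝ))⁻¹) atTop (𝓝 0) := tendsto_inv_atTop_zero.comp hsq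
    have hi2 : Tendsto (fun n => (t n : ℝ)⁻¹) atTop (𝓝 0) := tendsto_inv_atTop_zero.comp htR
    have e1 := ((hi1.const_mul (4 * |u| ^ 3)).mul hDt)
    have e2 := ((hi2.const_mul (u ^ 4 / 4)).mul (hV.pow 2))
    have e3 := ((hi2.const_mul (3 * u ^ 2)).mul hV)
    have e := (e1.add e2).add e3
    simp only [mul_zero, zero_mul, add_zero] at e
    refine e.congr' ?_
    filter_upwards [htR.eventually_gt_atTop 0] with n hn
    have hs : 0 < √(t n : ℝ) := Real.sqrt_pos.mpr hn
    have hss : (t n : ℝ) = √(t n : ℝ) ^ 2 := (Real.sq_sqrt hn.le).symm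
    rw [abs_div, abs_of_pos hs]
    generalize √(t n : ℝ) = q at *
    rw [hss]
    field_simp
    ring
  have hdiff := squeeze_zero_norm (fun n => h.norm_charFun_pow_mul_cexp_sub_le (t n) (a n)
    (u / √(t n))) herr
  have hmainC := (Complex.continuous_ofReal.tendsto _).comp hmain
  have := hdiff.add hmainC
  rw [zero_add] at this
  refine this.congr fun n => ?_
  simp only [Function.comp_apply, sub_add_cancel]

/-- A tilted law of zero variance is a point mass; by absolute continuity so is the original law,
and point masses are lattice. -/
lemma iteratedDeriv_two_pos (h : IsExpSemigroup μ ψ) (hlat : ¬ IsLatticeVar id (μ 1)) (a : ℝ) :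
    0 < iteratedDeriv 2 ψ a := by
  refine lt_of_le_of_ne (h.iteratedDeriv_two_nonneg a) fun h0 => hlat ?_
  have h1 := h.integral_sq_tilted 1 a
  rw [← h0, mul_zero, integral_eq_zero_iff_of_nonneg (fun x => sq_nonneg _)
    (h.integrable_sq_tilted 1 a _)] at h1
  have h2 := (absolutelyContinuous_tilted (h.integrable_exp 1 a)).ae_eq h1
  refine ⟨0, (1 : ℝ≥0) * deriv ψ a, h2.mono fun x hx => ⟨0, ?_⟩⟩
  have : x - (1 : ℝ≥0) * deriv ψ a = 0 := by simpa using hx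
  simp only [id]
  linarith

lemma strictMono_deriv (h : IsExpSemigroup μ ψ) (hlat : ¬ IsLatticeVar id (μ 1)) :
    StrictMono (deriv ψ) := by
  refine strictMono_of_deriv_pos fun a => ?_
  have := h.iteratedDeriv_two_pos hlat a
  rwa [iteratedDeriv_eq_iterate] at this

end IsExpSemigroup

/-! ### Change of measure and tail asymptotics. -/

lemma charFun_map_sub_const (ρ : Measure ℝ) (b s : ℝ) :
    charFun (ρ.map fun x => x - b) s = charFun ρ s * Complex.exp (-(s * b * Complex.I)) := by
  rw [charFun_mul_cexp_eq, charFun_apply_real, integral_map (by fun_prop) (by fun_prop)]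
  refine integral_congr_ae (ae_of_all _ fun x => ?_)
  simp

/-- Applied to `f = ψ'`, this supplies tilts whose mean equals the threshold exactly and which
converge to `α`. -/
lemma exists_tendsto_of_strictMono {f : ℝ → ℝ} (hf : StrictMono f) (hc : Continuous f)
    {y : ℕ → ℝ} {α : ℝ} (hy : Tendsto y atTop (𝓝 (f α))) :
    ∃ a : ℕ → ℝ, Tendsto a atTop (𝓝 α) ∧ ∀ᶠ n in atTop, f (a n) = y n := by
  classical
  have hex : ∀ᶠ n in atTop, ∃ a, f a = y n := by
    filter_upwards [hy.eventually_const_lt (hf (show α - 1 < α by linarith)),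
      hy.eventually_lt_const (hf (show α < α + 1 by linarith))] with n h1 h2
    obtain ⟨a, -, ha⟩ := intermediate_value_Icc (show α - 1 ≤ α + 1 by linarith)
      hc.continuousOn ⟨h1.le, h2.le⟩
    exact ⟨a, ha⟩
  -- The default `α` is taken only where the equation has no solution, which does not happen for
  -- large `n`.
  set a : ℕ → ℝ := fun n => if h : ∃ a, f a = y n then h.choose else α with ha
  have haf : ∀ᶠ n in atTop, f (a n) = y n := hex.mono fun n h => by
    simp only [ha, dif_pos h]; exact h.choose_spec
  refine ⟨a, tendsto_order.mpr ⟨fun u hu => ?_, fun u hu => ?_⟩, haf⟩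
  · filter_upwards [haf, hy.eventually_const_lt (hf hu)] with n h1 h2
    rw [← h1] at h2
    exact hf.lt_iff_lt.mp h2
  · filter_upwards [haf, hy.eventually_lt_const (hf hu)] with n h1 h2
    rw [← h1] at h2
    exact hf.lt_iff_lt.mp h2

lemma isEquivalent_of_tendsto_mul {u J c E F : ℕ → ℝ} {d : ℝ} (hd : 0 < d)
    (hc : ∀ᶠ n in atTop, 0 < c n) (hE : ∀ᶠ n in atTop, 0 < E n * F n)
    (hu : ∀ᶠ n in atTop, u n = E n * F n * J n)
    (hJ : Tendsto (fun n => c n * J n) atTop (𝓝 (1 / d))) :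
    u ~[atTop] fun n => E n / (d * c n) * F n := by
  refine isEquivalent_of_tendsto_one ?_
  have h := hJ.const_mul d
  rw [mul_one_div_cancel hd.ne'] at h
  refine h.congr' ?_
  filter_upwards [hc, hE, hu] with n h1 h2 h3
  rw [Pi.div_apply, h3]
  have hE0 : E n ≠ 0 := left_ne_zero_of_mul h2.ne'
  have hF0 : F n ≠ 0 := right_ne_zero_of_mul h2.ne'
  field_simp

namespace IsExpSemigroup

variable {μ : ℝ≥0 → Measure ℝ} {ψ : ℝ → ℝ}

/-- Change of measure. -/
lemma setIntegral_exp_eq (h : IsExpSemigroup μ ψ) (t : ℝ≥0) (κ a : ℝ) {s : Set ℝ}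
    (hs : MeasurableSet s) :
    ∫ x in s, Real.exp (κ * x) ∂(μ t) =
      Real.exp (t * ψ a) * ∫ x in s, Real.exp ((κ - a) * x) ∂((μ t).tilted (a * ·)) := by
  have hm : ∫ x, Real.exp (a * x) ∂(μ t) = Real.exp (t * ψ a) := h.mgf_eq t a
  rw [setIntegral_tilted' _ _ hs, hm, ← integral_const_mul]
  refine integral_congr_ae (ae_of_all _ fun x => ?_)
  simp only [smul_eq_mul]
  rw [div_mul_eq_mul_div, mul_div_cancel₀ _ (Real.exp_pos _).ne', ← Real.exp_add]
  ring_nf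

/-- With the tilt equal to `κ` the remaining integrand is `1`, leaving a probability. -/
lemma exp_neg_mul_setIntegral_exp (h : IsExpSemigroup μ ψ) (t : ℝ≥0) (κ : ℝ) {s : Set ℝ}
    (hs : MeasurableSet s) :
    Real.exp (-(ψ κ * t)) * ∫ x in s, Real.exp (κ * x) ∂(μ t) =
      ((μ t).tilted (κ * ·)).real s := by
  rw [h.setIntegral_exp_eq t κ κ hs, ← mul_assoc, ← Real.exp_add]
  simp [mul_comm]

/-- The weak law of large numbers for the tilted laws. -/
lemma tendsto_tilted_of_subset (h : IsExpSemigroup μ ψ) {t : ℕ → ℝ≥0}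
    (ht : Tendsto t atTop atTop) (κ : ℝ) {ε : ℝ} (hε : 0 < ε) {s : ℕ → Set ℝ}
    (hs : ∀ᶠ n in atTop, s n ⊆ {x | ε * t n ≤ |x - t n * deriv ψ κ|}) :
    Tendsto (fun n => ((μ (t n)).tilted (κ * ·)).real (s n)) atTop (𝓝 0) := by
  have htR : Tendsto (fun n => (t n : ℝ)) atTop atTop := NNReal.tendsto_coe_atTop.mpr ht
  have hlim : Tendsto (fun n => iteratedDeriv 2 ψ κ / ε ^ 2 / t n) atTop (𝓝 0) :=
    tendsto_const_nhds.div_atTop htR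
  refine squeeze_zero' (Eventually.of_forall fun _ => measureReal_nonneg) ?_ hlim
  filter_upwards [hs, htR.eventually_gt_atTop 0] with n hn htn
  have hp := h.isProbabilityMeasure_tilted (t n) κ
  -- Chebyshev's inequality: the variance is of order `t`, the squared deviation of order `t ^ 2`.
  have h1 := mul_meas_ge_le_integral_of_nonneg (μ := (μ (t n)).tilted (κ * ·))
    (ae_of_all _ fun x => sq_nonneg (x - t n * deriv ψ κ))
    (h.integrable_sq_tilted (t n) κ _) ((ε * t n) ^ 2)
  rw [h.integral_sq_tilted] at h1
  have h2 : ((μ (t n)).tilted (κ * ·)).real (s n) ≤ ((μ (t n)).tilted (κ * ·)).real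
      {x | (ε * t n) ^ 2 ≤ (x - t n * deriv ψ κ) ^ 2} := by
    refine measureReal_mono fun x hx => ?_
    have := hn hx
    simp only [Set.mem_ofPred_eq] at this ⊢
    rw [← sq_abs (x - _)]
    gcongr
  have h3 := (mul_le_mul_of_nonneg_left h2 (sq_nonneg (ε * t n))).trans h1
  rw [div_div, le_div_iff₀ (by positivity)]
  have h4 : (t n : ℝ) * (((μ (t n)).tilted (κ * ·)).real (s n) * (ε ^ 2 * t n)) ≤
      t n * iteratedDeriv 2 ψ κ := by
    refine le_trans (le_of_eq ?_) h3
    ring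
  exact le_of_mul_le_mul_left h4 htn

lemma tendsto_tilted_Ioi (h : IsExpSemigroup μ ψ) {t : ℕ → ℝ≥0}
    (ht : Tendsto t atTop atTop) (κ : ℝ) {b : ℕ → ℝ}
    (hb : ((deriv ψ κ : ℝ) : EReal) < liminf (fun n => ((b n / t n : ℝ) : EReal)) atTop) :
    Tendsto (fun n => ((μ (t n)).tilted (κ * ·)).real (Set.Ioi (b n))) atTop (𝓝 0) := by
  -- A real level `r` strictly between makes the event a deviation of at least `(r - ψ'(κ)) t`, even
  -- when the lower limit is infinite.
  obtain ⟨r, hr1, hr2⟩ := EReal.lt_iff_exists_real_btwn.mp hb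
  rw [EReal.coe_lt_coe_iff] at hr1
  refine h.tendsto_tilted_of_subset ht κ (sub_pos.mpr hr1) ?_
  have htR : Tendsto (fun n => (t n : ℝ)) atTop atTop := NNReal.tendsto_coe_atTop.mpr ht
  filter_upwards [eventually_lt_of_lt_liminf hr2, htR.eventually_gt_atTop 0] with n hn htn x hx
  rw [EReal.coe_lt_coe_iff, lt_div_iff₀ htn] at hn
  have hx : b n < x := hx
  have := le_abs_self (x - t n * deriv ψ κ)
  simp only [Set.mem_ofPred_eq]
  linarith

lemma tendsto_tilted_Iic (h : IsExpSemigroup μ ψ) {t : ℕ → ℝ≥0}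
    (ht : Tendsto t atTop atTop) (κ : ℝ) {b : ℕ → ℝ}
    (hb : limsup (fun n => ((b n / t n : ℝ) : EReal)) atTop < ((deriv ψ κ : ℝ) : EReal)) :
    Tendsto (fun n => ((μ (t n)).tilted (κ * ·)).real (Set.Iic (b n))) atTop (𝓝 0) := by
  obtain ⟨r, hr1, hr2⟩ := EReal.lt_iff_exists_real_btwn.mp hb
  rw [EReal.coe_lt_coe_iff] at hr2
  refine h.tendsto_tilted_of_subset ht κ (sub_pos.mpr hr2) ?_
  have htR : Tendsto (fun n => (t n : ℝ)) atTop atTop := NNReal.tendsto_coe_atTop.mpr ht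
  filter_upwards [eventually_lt_of_limsup_lt hr1, htR.eventually_gt_atTop 0] with n hn htn x hx
  rw [EReal.coe_lt_coe_iff, div_lt_iff₀ htn] at hn
  have hx : x ≤ b n := hx
  have := neg_le_abs (x - t n * deriv ψ κ)
  simp only [Set.mem_ofPred_eq]
  linarith

/-- The central limit theorem for the tilted laws, in terms of distribution functions. -/
theorem tendsto_tilted_Iic_cdf (h : IsExpSemigroup μ ψ) (hlat : ¬ IsLatticeVar id (μ 1))
    {t : ℕ → ℝ≥0} (ht : Tendsto t atTop atTop) (κ : ℝ) {b : ℕ → ℝ} {ϑ : ℝ}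
    (hb : (fun n => b n - (deriv ψ κ * t n + ϑ * √(iteratedDeriv 2 ψ κ * t n)))
      =o[atTop] (fun n => √(t n : ℝ))) :
    Tendsto (fun n => ((μ (t n)).tilted (κ * ·)).real (Set.Iic (b n))) atTop
      (𝓝 (cdf (gaussianReal 0 1) ϑ)) := by
  have htR : Tendsto (fun n => (t n : ℝ)) atTop atTop := NNReal.tendsto_coe_atTop.mpr ht
  have hv := h.iteratedDeriv_two_pos hlat κ
  set v := iteratedDeriv 2 ψ κ
  set σ := √v
  have hσ : 0 < σ := Real.sqrt_pos.mpr hv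
  have hσ2 : σ ^ 2 = v := Real.sq_sqrt hv.le
  have hp : ∀ n, IsProbabilityMeasure ((μ (t n)).tilted (κ * ·)) := fun n =>
    h.isProbabilityMeasure_tilted (t n) κ
  -- Normalised so that `T n x ≤ ϑ` holds exactly when `x ≤ b n`: the moving threshold becomes a
  -- fixed one.
  let T : ℕ → ℝ → ℝ := fun n x => (σ * √(t n : ℝ))⁻¹ * (x - b n) + ϑ
  have hTm : ∀ n, Measurable (T n) := fun n => by fun_prop
  have hpm : ∀ n, IsProbabilityMeasure (((μ (t n)).tilted (κ * ·)).map (T n)) := fun n =>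
    Measure.isProbabilityMeasure_map (hTm n).aemeasurable
  let m : ℕ → ProbabilityMeasure ℝ := fun n => ⟨_, hpm n⟩
  let m₀ : ProbabilityMeasure ℝ := ⟨gaussianReal 0 1, inferInstance⟩
  have hdev : Tendsto (fun n => (b n - t n * deriv ψ κ) / √(t n : ℝ)) atTop (𝓝 (ϑ * σ)) := by
    have h1 := hb.tendsto_div_nhds_zero.add_const (ϑ * σ)
    rw [zero_add] at h1
    refine h1.congr' ?_
    filter_upwards [htR.eventually_gt_atTop 0] with n hn
    have hs : 0 < √(t n : ℝ) := Real.sqrt_pos.mpr hn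
    rw [Real.sqrt_mul hv.le]
    field_simp
    ring
  have hweak : Tendsto m atTop (𝓝 m₀) := by
    rw [ProbabilityMeasure.tendsto_iff_tendsto_charFun]
    intro s
    simp only [m, m₀, ProbabilityMeasure.coe_mk, charFun_gaussianReal]
    have h1 := h.tendsto_charFun ht (tendsto_const_nhds (x := κ)) (s / σ)
    -- The phase left from centring at `b n` instead of the mean; it disappears in the limit by
    -- `hdev`.
    have h2 : Tendsto (fun n => Complex.exp ((s / σ * (ϑ * σ -
        (b n - t n * deriv ψ κ) / √(t n : ℝ)) : ℝ) * Complex.I)) atTop (𝓝 1) := by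
      have hc : Continuous fun y : ℝ => Complex.exp ((s / σ * (ϑ * σ - y) : ℝ) * Complex.I) := by
        fun_prop
      have := (hc.tendsto (ϑ * σ)).comp hdev
      simpa [Function.comp_def] using this
    have h3 := h1.mul h2
    have hval : ((Real.exp (-(v * (s / σ) ^ 2 / 2)) : ℝ) : ℂ) * 1 =
        Complex.exp (s * (0 : ℝ) * Complex.I - (1 : ℝ≥0) * s ^ 2 / 2) := by
      rw [← hσ2, mul_one, Complex.ofReal_exp]
      congr 1
      have : -(σ ^ 2 * (s / σ) ^ 2 / 2) = -(s ^ 2 / 2) := by field_simp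
      rw [this]
      push_cast
      ring
    rw [hval] at h3
    refine h3.congr' ?_
    filter_upwards [htR.eventually_gt_atTop 0] with n hn
    have hs : 0 < √(t n : ℝ) := Real.sqrt_pos.mpr hn
    rw [charFun_apply_real, charFun_apply_real, integral_map (hTm n).aemeasurable (by fun_prop),
      mul_assoc, ← Complex.exp_add, ← integral_mul_const]
    refine integral_congr_ae (ae_of_all _ fun x => ?_)
    simp only [T]
    rw [← Complex.exp_add]
    congr 1
    have hkey : s / σ / √(t n : ℝ) * x + (-(s / σ / √(t n : ℝ) * (t n * deriv ψ κ)) +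
        s / σ * (ϑ * σ - (b n - t n * deriv ψ κ) / √(t n : ℝ))) =
        s * ((σ * √(t n : ℝ))⁻¹ * (x - b n) + ϑ) := by
      field_simp
      ring
    have hkeyC := congrArg (fun y : ℝ => (y : ℂ) * Complex.I) hkey
    push_cast at hkeyC ⊢
    rw [← hkeyC]
    ring
  have hfr : (m₀ : Measure ℝ) (frontier (Set.Iic ϑ)) = 0 := by
    rw [frontier_Iic]
    have := nullSingletonClass_gaussianReal (μ := 0) (v := 1) one_ne_zero
    exact measure_singleton (μ := gaussianReal 0 1) ϑ
  have hlim := ProbabilityMeasure.tendsto_measure_of_null_frontier_of_tendsto' hweak hfr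
  have hlim' := (ENNReal.tendsto_toReal (measure_ne_top _ _)).comp hlim
  rw [cdf_eq_real]
  refine hlim'.congr' ?_
  filter_upwards [htR.eventually_gt_atTop 0] with n hn
  have hs : 0 < √(t n : ℝ) := Real.sqrt_pos.mpr hn
  simp only [Function.comp_apply, m, ProbabilityMeasure.coe_mk]
  rw [Measure.map_apply (hTm n) measurableSet_Iic, measureReal_def]
  congr 2
  ext x
  simp only [T, Set.mem_preimage, Set.mem_Iic, add_le_iff_nonpos_left]
  rw [mul_nonpos_iff_neg_imp_nonneg]
  have h0 : 0 < (σ * √(t n : ℝ))⁻¹ := by positivity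
  constructor
  · intro hx
    by_contra hlt
    nlinarith [hx.2 (by linarith)]
  · intro hx
    constructor <;> intro <;> linarith

lemma legendreTransform_deriv (h : IsExpSemigroup μ ψ) (a : ℝ) :
    legendreTransform ψ (deriv ψ a) = a * deriv ψ a - ψ a := by
  have := h.isProbabilityMeasure 1
  have h1 := legendreTransform_cgf_deriv (μ 1) id (h.integrable_exp 1) a
  rwa [← h.eq_cgf] at h1

/-- Change of measure with the tilt centred at the threshold. -/
lemma setIntegral_exp_eq_legendre (h : IsExpSemigroup μ ψ) {t : ℝ≥0} (ht : 0 < t) (κ : ℝ)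
    {a b : ℝ} (hab : deriv ψ a = b / t) {s : Set ℝ} (hs : MeasurableSet s) :
    ∫ x in (fun x => x - t * deriv ψ a) ⁻¹' s, Real.exp (κ * x) ∂(μ t) =
      Real.exp (κ * b) * Real.exp (-(legendreTransform ψ (b / t) * t)) *
        ∫ y in s, Real.exp ((κ - a) * y)
          ∂(((μ t).tilted (a * ·)).map fun x => x - t * deriv ψ a) := by
  have ht' : (t : ℝ) ≠ 0 := by exact_mod_cast ht.ne'
  have hb : t * deriv ψ a = b := by rw [hab]; field_simp
  have hm : Measurable fun x : ℝ => x - t * deriv ψ a := by fun_prop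
  rw [h.setIntegral_exp_eq t κ a (hm hs), setIntegral_map hs (by fun_prop) hm.aemeasurable,
    ← integral_const_mul, ← integral_const_mul, ← hab, h.legendreTransform_deriv]
  refine integral_congr_ae (ae_of_all _ fun x => ?_)
  simp only [← Real.exp_add]
  congr 1
  -- Since `t ψ'(a) = b`, one has `t ψ(a) = a b - t I(b / t)`, so the exponents combine to `κ b - t
  -- I(b / t) + (κ - a) (x - b)`.
  rw [← hb]
  ring

/-- Exact asymptotics of the upper tail integral. -/
theorem isEquivalent_setIntegral_Ioi (h : IsExpSemigroup μ ψ) (hlat : ¬ IsLatticeVar id (μ 1))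
    {t : ℕ → ℝ≥0} (ht : Tendsto t atTop atTop) {κ α : ℝ} (hα : κ < α) {b : ℕ → ℝ}
    (hb : Tendsto (fun n => b n / t n) atTop (𝓝 (deriv ψ α))) :
    (fun n => ∫ x in Set.Ioi (b n), Real.exp (κ * x) ∂(μ (t n))) ~[atTop]
      fun n => Real.exp (κ * b n) / ((α - κ) * √(2 * Real.pi * iteratedDeriv 2 ψ α * t n)) *
        Real.exp (-(legendreTransform ψ (b n / t n) * t n)) := by
  have hpi := Real.pi_pos
  have htR : Tendsto (fun n => (t n : ℝ)) atTop atTop := NNReal.tendsto_coe_atTop.mpr ht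
  have hv := h.iteratedDeriv_two_pos hlat α
  obtain ⟨a, ha, hab⟩ := exists_tendsto_of_strictMono (h.strictMono_deriv hlat)
    h.differentiable_deriv.continuous hb
  have hp : ∀ n, IsProbabilityMeasure ((μ (t n)).tilted (a n * ·)) := fun n =>
    h.isProbabilityMeasure_tilted (t n) (a n)
  have hpm : ∀ n, IsProbabilityMeasure (((μ (t n)).tilted (a n * ·)).map
      fun x => x - t n * deriv ψ (a n)) := fun n =>
    Measure.isProbabilityMeasure_map (by fun_prop)
  -- The rates are `a n - κ → α - κ > 0`. Centring multiplies the characteristic function by a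
  -- phase, so the Gaussian domination is unaffected.
  have hJ := tendsto_integral_exp_of_gaussian htR hv
    (m := fun n => ((μ (t n)).tilted (a n * ·)).map fun x => x - t n * deriv ψ (a n))
    (fun u => by simpa only [charFun_map_sub_const] using h.tendsto_charFun ht ha u)
    (fun S => by
      obtain ⟨c, hc, hbd⟩ := h.exists_norm_charFun_le hlat ht ha S
      refine ⟨c, hc, hbd.mono fun n hn s hs => ?_⟩
      rw [charFun_map_sub_const, norm_mul, show -((s : ℂ) * (t n * deriv ψ (a n) : ℝ) * Complex.I) =
        ((-(s * (t n * deriv ψ (a n))) : ℝ) : ℂ) * Complex.I by push_cast; ring,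
        Complex.norm_exp_ofReal_mul_I, mul_one]
      exact hn s hs)
    (sub_pos.mpr hα) (ha.sub_const κ) measurableSet_Ioi subset_rfl Set.Ioi_subset_Ici_self
  refine isEquivalent_of_tendsto_mul (sub_pos.mpr hα) ?_
    (Eventually.of_forall fun n => by positivity) ?_ hJ
  · filter_upwards [htR.eventually_gt_atTop 0] with n hn
    positivity
  · filter_upwards [hab, ht.eventually_gt_atTop 0] with n hn htn
    have h1 := h.setIntegral_exp_eq_legendre htn κ hn measurableSet_Ioi (s := Set.Ioi 0)
    have htn' : (t n : ℝ) ≠ 0 := by exact_mod_cast htn.ne'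
    have hset : (fun x => x - t n * deriv ψ (a n)) ⁻¹' Set.Ioi 0 = Set.Ioi (b n) := by
      ext x
      simp only [Set.mem_preimage, Set.mem_Ioi, sub_pos, hn, mul_div_cancel₀ _ htn']
    rw [hset] at h1
    rw [h1]
    simp only [← neg_mul, neg_sub]

/-- Exact asymptotics of the lower tail integral. -/
theorem isEquivalent_setIntegral_Iic (h : IsExpSemigroup μ ψ) (hlat : ¬ IsLatticeVar id (μ 1))
    {t : ℕ → ℝ≥0} (ht : Tendsto t atTop atTop) {κ α : ℝ} (hα : α < κ) {b : ℕ → ℝ}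
    (hb : Tendsto (fun n => b n / t n) atTop (𝓝 (deriv ψ α))) :
    (fun n => ∫ x in Set.Iic (b n), Real.exp (κ * x) ∂(μ (t n))) ~[atTop]
      fun n => Real.exp (κ * b n) / ((κ - α) * √(2 * Real.pi * iteratedDeriv 2 ψ α * t n)) *
        Real.exp (-(legendreTransform ψ (b n / t n) * t n)) := by
  have hpi := Real.pi_pos
  have htR : Tendsto (fun n => (t n : ℝ)) atTop atTop := NNReal.tendsto_coe_atTop.mpr ht
  have hv := h.iteratedDeriv_two_pos hlat α
  obtain ⟨a, ha, hab⟩ := exists_tendsto_of_strictMono (h.strictMono_deriv hlat)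
    h.differentiable_deriv.continuous hb
  have hp : ∀ n, IsProbabilityMeasure ((μ (t n)).tilted (a n * ·)) := fun n =>
    h.isProbabilityMeasure_tilted (t n) (a n)
  have hpm : ∀ n, IsProbabilityMeasure (((μ (t n)).tilted (a n * ·)).map
      fun x => x - t n * deriv ψ (a n)) := fun n =>
    Measure.isProbabilityMeasure_map (by fun_prop)
  -- Here `κ - a n → κ - α > 0`, so the integrand decays towards `-∞` and the reflected limit
  -- theorem applies.
  have hJ := tendsto_integral_exp_of_gaussian_neg htR hv
    (m := fun n => ((μ (t n)).tilted (a n * ·)).map fun x => x - t n * deriv ψ (a n))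
    (fun u => by simpa only [charFun_map_sub_const] using h.tendsto_charFun ht ha u)
    (fun S => by
      obtain ⟨c, hc, hbd⟩ := h.exists_norm_charFun_le hlat ht ha S
      refine ⟨c, hc, hbd.mono fun n hn s hs => ?_⟩
      rw [charFun_map_sub_const, norm_mul, show -((s : ℂ) * (t n * deriv ψ (a n) : ℝ) * Complex.I) =
        ((-(s * (t n * deriv ψ (a n))) : ℝ) : ℂ) * Complex.I by push_cast; ring,
        Complex.norm_exp_ofReal_mul_I, mul_one]
      exact hn s hs)
    (sub_pos.mpr hα) (tendsto_const_nhds.sub ha)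
  refine isEquivalent_of_tendsto_mul (sub_pos.mpr hα) ?_
    (Eventually.of_forall fun n => by positivity) ?_ hJ
  · filter_upwards [htR.eventually_gt_atTop 0] with n hn
    positivity
  · filter_upwards [hab, ht.eventually_gt_atTop 0] with n hn htn
    have h1 := h.setIntegral_exp_eq_legendre htn κ hn measurableSet_Iic (s := Set.Iic 0)
    have htn' : (t n : ℝ) ≠ 0 := by exact_mod_cast htn.ne'
    have hset : (fun x => x - t n * deriv ψ (a n)) ⁻¹' Set.Iic 0 = Set.Iic (b n) := by
      ext x
      simp only [Set.mem_preimage, Set.mem_Iic, sub_nonpos, hn, mul_div_cancel₀ _ htn']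
    rw [hset] at h1
    exact h1

end IsExpSemigroup

theorem proposition2p1 {Ω : Type*} [MeasurableSpace Ω] (P : Measure Ω) [IsProbabilityMeasure P]
    (ξ : ℝ≥0 → Ω → ℝ) (hξ : IsLevyProcess ξ P)
    (hexp : ∀ u : ℝ, Integrable (fun ω => Real.exp (u * ξ 1 ω)) P)
    (hlat : ¬ IsLatticeVar (ξ 1) P)
    (ψ : ℝ → ℝ) (hψ : ψ = cgf (ξ 1) P)
    (I : ℝ → ℝ) (hI : I = legendreTransform ψ)
    (κ : ℝ) (hκ : 0 ≤ κ)
    (b : ℕ → ℝ) (hb : Tendsto b atTop atTop)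
    (x : ℕ → ℝ≥0) (hx : Tendsto x atTop atTop) :
    -- the exponential moments below are finite
    (∀ t : ℝ≥0, Integrable (fun ω => Real.exp (κ * ξ t ω)) P) ∧
    -- part 1
    (∀ ϑ : ℝ,
      (fun N => b N - (deriv ψ κ * x N + ϑ * √(iteratedDeriv 2 ψ κ * x N)))
        =o[atTop] (fun N => √(x N : ℝ)) →
      Tendsto (fun N => Real.exp (-(ψ κ * x N)) *
          ∫ ω in {ω | ξ (x N) ω ≤ b N}, Real.exp (κ * ξ (x N) ω) ∂P)
        atTop (𝓝 (cdf (gaussianReal 0 1) ϑ))) ∧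
    -- part 2
    (((deriv ψ κ : ℝ) : EReal) < liminf (fun N => ((b N / x N : ℝ) : EReal)) atTop →
      Tendsto (fun N => Real.exp (-(ψ κ * x N)) *
          ∫ ω in {ω | b N < ξ (x N) ω}, Real.exp (κ * ξ (x N) ω) ∂P)
        atTop (𝓝 0)) ∧
    (∀ α : ℝ, κ < α → Tendsto (fun N => b N / x N) atTop (𝓝 (deriv ψ α)) →
      (fun N => ∫ ω in {ω | b N < ξ (x N) ω}, Real.exp (κ * ξ (x N) ω) ∂P)
        ~[atTop] (fun N => Real.exp (κ * b N) /
            ((α - κ) * √(2 * Real.pi * iteratedDeriv 2 ψ α * x N)) *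
          Real.exp (-(I (b N / x N) * x N)))) ∧
    -- part 3
    (limsup (fun N => ((b N / x N : ℝ) : EReal)) atTop < ((deriv ψ κ : ℝ) : EReal) →
      Tendsto (fun N => Real.exp (-(ψ κ * x N)) *
          ∫ ω in {ω | ξ (x N) ω ≤ b N}, Real.exp (κ * ξ (x N) ω) ∂P)
        atTop (𝓝 0)) ∧
    (∀ α : ℝ, 0 < α → α < κ → Tendsto (fun N => b N / x N) atTop (𝓝 (deriv ψ α)) →
      (fun N => ∫ ω in {ω | ξ (x N) ω ≤ b N}, Real.exp (κ * ξ (x N) ω) ∂P)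
        ~[atTop] (fun N => Real.exp (κ * b N) /
            ((κ - α) * √(2 * Real.pi * iteratedDeriv 2 ψ α * x N)) *
          Real.exp (-(I (b N / x N) * x N)))) := by
  have hS : IsExpSemigroup (fun t => P.map (ξ t)) ψ := hψ ▸ hξ.isExpSemigroup hexp
  have hlat' : ¬ IsLatticeVar id (P.map (ξ 1)) := fun ⟨a, c, h⟩ =>
    hlat ⟨a, c, ae_of_ae_map (hξ.measurable 1).aemeasurable h⟩
  have hint : ∀ (t : ℝ≥0) (s : Set ℝ), MeasurableSet s →
      ∫ ω in {ω | ξ t ω ∈ s}, Real.exp (κ * ξ t ω) ∂P =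
        ∫ y in s, Real.exp (κ * y) ∂(P.map (ξ t)) := fun t s hs =>
    (setIntegral_map (f := fun y => Real.exp (κ * y)) hs (by fun_prop)
      (hξ.measurable t).aemeasurable).symm
  have hIic : ∀ n, ∫ ω in {ω | ξ (x n) ω ≤ b n}, Real.exp (κ * ξ (x n) ω) ∂P =
      ∫ y in Set.Iic (b n), Real.exp (κ * y) ∂(P.map (ξ (x n))) := fun n =>
    hint (x n) _ measurableSet_Iic
  have hIoi : ∀ n, ∫ ω in {ω | b n < ξ (x n) ω}, Real.exp (κ * ξ (x n) ω) ∂P =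
      ∫ y in Set.Ioi (b n), Real.exp (κ * y) ∂(P.map (ξ (x n))) := fun n =>
    hint (x n) _ measurableSet_Ioi
  have hmass : ∀ n (s : Set ℝ), MeasurableSet s → Real.exp (-(ψ κ * x n)) *
      ∫ y in s, Real.exp (κ * y) ∂(P.map (ξ (x n))) =
        ((P.map (ξ (x n))).tilted (κ * ·)).real s := fun n s hs =>
    hS.exp_neg_mul_setIntegral_exp (x n) κ hs
  -- All claims now concern only the laws `P.map (ξ t)` and their tilts.
  simp only [hIic, hIoi, hmass _ _ measurableSet_Iic, hmass _ _ measurableSet_Ioi, hI]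
  exact ⟨fun t => hξ.integrable_exp_mul (hexp κ) t,
    fun ϑ h => hS.tendsto_tilted_Iic_cdf hlat' hx κ h,
    fun h => hS.tendsto_tilted_Ioi hx κ h,
    fun α hα h => hS.isEquivalent_setIntegral_Ioi hlat' hx hα h,
    fun h => hS.tendsto_tilted_Iic hx κ h,
    fun α _ hα h => hS.isEquivalent_setIntegral_Iic hlat' hx hα h⟩
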